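/- **Setting.** Let $\mathbb K$ be an algebraically closed field of characteristic zero, $M=\mathbb Z^{n-1}$ the character lattice of the torus $T=(\mathbb K^*)^{n-1}$, and $A\subseteq M$ a finite set whose affine span is $\mathbb R^{n-1}$; put $P=\mathrm{conv}(A)$. For a set $D\subseteq\mathbb R^{n-1}$ let $K(D)=\{c\,(1,u)\mid c\ge 0,\ u\in D\}\subseteq\mathbb R^n$. Elements of $\mathbb R^{n-1}$ are identified with their images under $u\mapsto(1,u)$. The spaces $\mathbb R^N$ and $\mathbb Q^N$ are ordered lexicographically, the first coordinate being the most significant one. Let $\hat X_A\subseteq\mathbb K^A$ be the Zariski closure of the image of $\mathbb K^*\times T\to\mathbb K^A$, $(c,t)\mapsto\sum_{\chi\in A}c\,\chi(t)e_\chi$. It is the affine cone over the embedded toric variety $X_A\subseteq\mathbb P(\mathbb K^A)$. Let $\rho:\mathbb K[x_\chi\mid\chi\in A]\to\mathbb K[\hat X_A]$ be the restriction map, and grade $\mathbb K[\hat X_A]$ by degree. A *polytopal subdivision* $\mathcal Q$ of $(P,A)$ is a finite set of marked polytopes $(Q,A_Q)$ with $A_Q\subseteq A$ and $Q=\mathrm{conv}(A_Q)$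 of dimension $n-1$, such that $\bigcup Q=P$ and such that for different $(Q,A_Q),(Q',A_{Q'})\in\mathcal Q$ the intersection $Q\cap Q'$ is empty or a face of both, and $A_Q\cap Q\cap Q'=A_{Q'}\cap Q\cap Q'$. Let $A_{\mathcal Q}=\bigcup A_Q$. The *(open) GKZ-cone* $C(\mathcal Q,N)$ is the set of real $N\times A$-matrices $\Psi$ with columns $\Psi(\chi)$ for which there is a map $g:K(P)\to\mathbb R^N$ such that * $g$ is continuous, linear on each $K(Q)$, and convex upward, i.e. $g(tu+(1-t)v)\ge tg(u)+(1-t)g(v)$ for $u,v\in K(P)$ and $t\in[0,1]$; * $g(\chi)=\Psi(\chi)$ for $\chi\in A_{\mathcal Q}$ and $g(\chi)\ge\Psi(\chi)$ for $\chi\in A\setminus A_{\mathcal Q}$; * the pairs $(D,\{\chi\in A\cap D\mid g(\chi)=\Psi(\chi)\})$, where $D$ runs over the domains of linearity of $g$, are exactly the marked polytopes of $\mathcal Q$. Here a domain of linearity is a maximal set $D\subseteq P$ among the closures of nonempty connected open subsets of $P$ for which $g$ is linear on $K(D)$. For $\Psi\in M_{N,A}(\mathbb Q)$ let $\nu_\Psi:\mathbb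 K[\hat X_A]\to\mathbb Q^N\cup\{\infty\}$ be the quasi-valuation $\nu_\Psi(f)=\max\{\mathfrak v_\Psi(p)\mid\rho(p)=f\}$, where $\mathfrak v_\Psi(p)=\min\{\Psi\cdot\alpha\mid x^\alpha\text{ occurs in }p\}$ and $\mathfrak v_\Psi(0)=\infty$. Let $\mathrm{gr}_{\nu_\Psi}\mathbb K[\hat X_A]=\bigoplus_{\mathbf a\in\mathbb Q^N}\{\nu_\Psi\ge\mathbf a\}/\{\nu_\Psi>\mathbf a\}$, and let $\mathrm{Red}$ denote the quotient by the nilradical. This algebra is $\mathbb N$-graded by the degree on $\mathbb K[\hat X_A]$. For $(Q,A_Q)\in\mathcal Q$ let $S^1_Q\subseteq\mathbb N\times M$ be the monoid generated by the elements $(1,\chi)$, $\chi\in A_Q$, and grade $\mathbb K[S^1_Q]$ by the first coordinate. **Theorem.** Let $\mathcal Q$ be a polytopal subdivision of $(P,A)$ and let $\Psi\in C(\mathcal Q,N)$ be a matrix with rational entries. 1. The $\mathbb K$-algebra $\mathrm{Red}(\mathrm{gr}_{\nu_\Psi}\mathbb K[\hat X_A])$ is finitely generated. 2. The scheme $Z_0=Z_0(\Psi)=\mathrm{Proj}(\mathrm{Red}(\mathrm{gr}_{\nu_\Psi}\mathbb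 K[\hat X_A]))$ is reduced. It is the irredundant union of the toric varieties $Z_Q=\mathrm{Proj}(\mathbb K[S^1_Q])$, $Q\in\mathcal Q$. That is, each $Z_Q$ is integral and isomorphic over $\mathbb K$ to the embedded toric variety $X_{A_Q}$, and there are closed immersions $\iota_{\Psi,Q}:Z_Q\to Z_0$ over $\mathbb K$ whose images cover $Z_0$, no image being contained in the union of the others. 3. Every irreducible component of $Z_0$ has dimension $\dim X_A$. 4. $Z_0$ depends only on $\mathcal Q$: the closed immersions in 2 can be chosen for all $\Psi$ simultaneously in such a way that for any rational $\Psi\in C(\mathcal Q,N)$ and $\Psi'\in C(\mathcal Q,N')$ there is an isomorphism $e:Z_0(\Psi)\to Z_0(\Psi')$ of $\mathbb K$-schemes with $e\circ\iota_{\Psi,Q}=\iota_{\Psi',Q}$ for all $Q\in\mathcal Q$. -/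

import Mathlib

noncomputable section

namespace HigherGKZ

universe u

/-! ### Marked polytopes and polytopal subdivisions -/

/-- The inclusion of the lattice `M = ℤ^d` into `M_ℝ = ℝ^d`. -/
def latticePt {d : ℕ} (m : Fin d → ℤ) : Fin d → ℝ := fun i => (m i : ℝ)

/-- The polytope `conv(s)` spanned by a finite set `s` of lattice points. -/
def polytope {d : ℕ} (s : Finset (Fin d → ℤ)) : Set (Fin d → ℝ) :=
  convexHull ℝ (latticePt '' (s : Set (Fin d → ℤ)))

/-- A polytopal subdivision of the marked polytope `(conv A, A)` by marked polytopes.  A marked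
polytope is a pair `(Q, A_Q)` with `Q = conv(A_Q)`; it is recorded by its marking `A_Q`. -/
structure PolytopalSubdivision {d : ℕ} (A : Finset (Fin d → ℤ)) where
  /-- the markings `A_Q` of the polytopes `Q` of the subdivision -/
  cells : Finset (Finset (Fin d → ℤ))
  marks_subset : ∀ s ∈ cells, s ⊆ A
  full_dim : ∀ s ∈ cells, affineSpan ℝ (polytope s) = ⊤
  cover : ⋃ s ∈ cells, polytope s = polytope A
  /-- two different polytopes are disjoint or meet in a common face -/
  face_inter : ∀ s ∈ cells, ∀ t ∈ cells, s ≠ t →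
    polytope s ∩ polytope t = ∅ ∨
      (IsExposed ℝ (polytope s) (polytope s ∩ polytope t) ∧
        IsExposed ℝ (polytope t) (polytope s ∩ polytope t))
  /-- the markings agree on the intersections -/
  marks_inter : ∀ s ∈ cells, ∀ t ∈ cells, s ≠ t →
    latticePt '' (s : Set (Fin d → ℤ)) ∩ (polytope s ∩ polytope t) =
      latticePt '' (t : Set (Fin d → ℤ)) ∩ (polytope s ∩ polytope t)

/-- The pairs `(Q, A_Q)` of a subdivision. -/
def PolytopalSubdivision.markedPolytopes {d : ℕ} {A : Finset (Fin d → ℤ)}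
    (Q : PolytopalSubdivision A) : Set (Set (Fin d → ℝ) × Set (Fin d → ℤ)) :=
  {p | ∃ s ∈ Q.cells, p = (polytope s, (s : Set (Fin d → ℤ)))}

/-! ### Piecewise linear maps and the open GKZ-cones -/

/-- The cone `K(D) ⊆ ℝ × ℝ^d` over a set `D ⊆ ℝ^d`, which is embedded by `u ↦ (1, u)`. -/
def coneOver {d : ℕ} (D : Set (Fin d → ℝ)) : Set (ℝ × (Fin d → ℝ)) :=
  {x | ∃ c : ℝ, 0 ≤ c ∧ ∃ u ∈ D, x = c • ((1 : ℝ), u)}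

/-- `g` is linear on the cone `K(D)`. -/
def LinearOnCone {d N : ℕ} (g : ℝ × (Fin d → ℝ) → Fin N → ℝ) (D : Set (Fin d → ℝ)) : Prop :=
  ∃ ψ : (ℝ × (Fin d → ℝ)) →ₗ[ℝ] (Fin N → ℝ), ∀ x ∈ coneOver D, g x = ψ x

/-- `g` is convex upward on `C`; the values in `ℝ^N` are compared lexicographically. -/
def ConvexUpward {d N : ℕ} (C : Set (ℝ × (Fin d → ℝ)))
    (g : ℝ × (Fin d → ℝ) → Fin N → ℝ) : Prop :=
  ContinuousOn g C ∧ ∀ u ∈ C, ∀ v ∈ C, ∀ t : ℝ, 0 ≤ t → t ≤ 1 →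
    toLex (t • g u + (1 - t) • g v) ≤ toLex (g (t • u + (1 - t) • v))

/-- `D` is a domain contained in `P`: the closure of a nonempty connected open subset of `P`
(with `D ⊆ P`, as `P` is closed in all applications). -/
def IsDomainIn {d : ℕ} (P D : Set (Fin d → ℝ)) : Prop :=
  D ⊆ P ∧ ∃ U : Set (Fin d → ℝ), IsOpen U ∧ IsConnected U ∧ U ⊆ P ∧ D = closure U

/-- `D` is a domain of linearity of `g : K(P) → ℝ^N`. -/
def IsDomainOfLinearity {d N : ℕ} (P : Set (Fin d → ℝ)) (g : ℝ × (Fin d → ℝ) → Fin N → ℝ)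
    (D : Set (Fin d → ℝ)) : Prop :=
  Maximal (fun D' => IsDomainIn P D' ∧ LinearOnCone g D') D

/-- `g` is a `𝒬`-piecewise linear and convex upward map on `K(P)` with `g(χ) = Ψ(χ)` for
`χ ∈ A_𝒬` and `g(χ) ≥ Ψ(χ)` for `χ ∈ A ∖ A_𝒬`, where `Ψ(χ)` is the column of `Ψ` with index `χ`.
(Only the values of `g` on `K(P)` matter.) -/
structure IsGKZMap {d N : ℕ} {A : Finset (Fin d → ℤ)} (Q : PolytopalSubdivision A)
    (Ψ : Matrix (Fin N) A ℝ) (g : ℝ × (Fin d → ℝ) → Fin N → ℝ) : Prop where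
  piecewise_linear : ∀ s ∈ Q.cells, LinearOnCone g (polytope s)
  convex_upward : ConvexUpward (coneOver (polytope A)) g
  eq_on_marks : ∀ χ : A, (∃ s ∈ Q.cells, (χ : Fin d → ℤ) ∈ s) →
    g (1, latticePt χ) = fun k => Ψ k χ
  ge_off_marks : ∀ χ : A, (¬ ∃ s ∈ Q.cells, (χ : Fin d → ℤ) ∈ s) →
    toLex (fun k => Ψ k χ) ≤ toLex (g (1, latticePt χ))

/-- The closed GKZ-cone of `𝒬` in the space of `N × A`-matrices. -/
def closedGKZCone {d : ℕ} {A : Finset (Fin d → ℤ)} (Q : PolytopalSubdivision A) (N : ℕ) :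
    Set (Matrix (Fin N) A ℝ) :=
  {Ψ | ∃ g, IsGKZMap Q Ψ g}

/-- The marked polytopes `(D, A_D)`, where `D` runs over the domains of linearity of `g` and
`A_D = {χ ∈ A ∩ D ∣ g(χ) = Ψ(χ)}`. -/
def linearityPolytopes {d N : ℕ} {A : Finset (Fin d → ℤ)} (Ψ : Matrix (Fin N) A ℝ)
    (g : ℝ × (Fin d → ℝ) → Fin N → ℝ) : Set (Set (Fin d → ℝ) × Set (Fin d → ℤ)) :=
  {p | IsDomainOfLinearity (polytope A) g p.1 ∧
    p.2 = {m | ∃ h : m ∈ A, latticePt m ∈ p.1 ∧ g (1, latticePt m) = fun k => Ψ k ⟨m, h⟩}}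

/-- The open GKZ-cone `C(𝒬, N)`: the matrices in the closed cone for which the domains of
linearity, with their markings, are exactly the marked polytopes of `𝒬`. -/
def openGKZCone {d : ℕ} {A : Finset (Fin d → ℤ)} (Q : PolytopalSubdivision A) (N : ℕ) :
    Set (Matrix (Fin N) A ℝ) :=
  {Ψ | ∃ g, IsGKZMap Q Ψ g ∧ linearityPolytopes Ψ g = Q.markedPolytopes}

/-! ### Gradings on quotients -/

theorem isInternal_of_proj {K M : Type*} [Field K] [AddCommGroup M] [Module K M]
    (𝒜 : ℕ → Submodule K M) (π : ℕ → M →ₗ[K] M) (h1 : ∀ m, ∀ x ∈ 𝒜 m, π m x = x)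
    (h2 : ∀ m n, m ≠ n → ∀ x ∈ 𝒜 n, π m x = 0) (h3 : ⨆ m, 𝒜 m = ⊤) :
    DirectSum.IsInternal 𝒜 := by
  rw [DirectSum.isInternal_submodule_iff_iSupIndep_and_iSup_eq_top]
  refine ⟨fun m => ?_, h3⟩
  rw [Submodule.disjoint_def]
  intro x hx hx'
  have hle : (⨆ (n) (_ : n ≠ m), 𝒜 n) ≤ LinearMap.ker (π m) :=
    iSup₂_le fun n hn y hy => h2 m n hn.symm y hy
  rw [← h1 m x hx]
  exact hle hx'

/-- The images of the homogeneous parts in the quotient by an ideal. -/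
def quotGrading {K R : Type*} [Field K] [CommRing R] [Algebra K R] (𝒜 : ℕ → Submodule K R)
    (I : Ideal R) (m : ℕ) : Submodule K (R ⧸ I) :=
  (𝒜 m).map (Ideal.Quotient.mkₐ K I).toLinearMap

/-- The quotient of a graded algebra by a homogeneous ideal is graded. -/
@[reducible] def quotGradedAlgebra {K R : Type*} [Field K] [CommRing R] [Algebra K R]
    (𝒜 : ℕ → Submodule K R) [GradedAlgebra 𝒜] (I : Ideal R) (hI : I.IsHomogeneous 𝒜) :
    GradedAlgebra (quotGrading 𝒜 I) :=
  haveI : SetLike.GradedMonoid (quotGrading 𝒜 I) :=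
    { one_mem := ⟨1, SetLike.GradedOne.one_mem, map_one (Ideal.Quotient.mkₐ K I)⟩
      mul_mem := by
        rintro i j _ _ ⟨x, hx, rfl⟩ ⟨y, hy, rfl⟩
        exact ⟨x * y, SetLike.GradedMul.mul_mem hx hy, map_mul (Ideal.Quotient.mkₐ K I) x y⟩ }
  { DirectSum.IsInternal.chooseDecomposition (quotGrading 𝒜 I) <| by
      let π : ℕ → (R ⧸ I) →ₗ[K] (R ⧸ I) := fun m =>
        Submodule.mapQ (I.restrictScalars K) (I.restrictScalars K)
          (GradedAlgebra.proj 𝒜 m) (fun x hx => hI m hx)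
      have hπ : ∀ m (x : R), π m (Ideal.Quotient.mkₐ K I x) =
          Ideal.Quotient.mkₐ K I (GradedAlgebra.proj 𝒜 m x) := fun m x => rfl
      refine isInternal_of_proj _ π ?_ ?_ ?_
      · rintro m _ ⟨x, hx, rfl⟩
        refine (hπ m x).trans ?_
        rw [GradedAlgebra.proj_apply, DirectSum.decompose_of_mem_same _ hx]; rfl
      · rintro m n hmn _ ⟨x, hx, rfl⟩
        refine (hπ m x).trans ?_
        rw [GradedAlgebra.proj_apply, DirectSum.decompose_of_mem_ne _ hx hmn.symm, map_zero]
      · unfold quotGrading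
        rw [← Submodule.map_iSup, (DirectSum.Decomposition.isInternal 𝒜).submodule_iSup_eq_top,
          Submodule.map_top, LinearMap.range_eq_top]
        exact Ideal.Quotient.mkₐ_surjective K I with }

theorem proj_quotGrading {K R : Type*} [Field K] [CommRing R] [Algebra K R]
    (𝒜 : ℕ → Submodule K R) [GradedAlgebra 𝒜] (I : Ideal R) [GradedAlgebra (quotGrading 𝒜 I)]
    (m : ℕ) (x : R) : GradedAlgebra.proj (quotGrading 𝒜 I) m (Ideal.Quotient.mk I x) =
      Ideal.Quotient.mk I (GradedAlgebra.proj 𝒜 m x) := by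
  induction x using DirectSum.Decomposition.inductionOn 𝒜 with
  | zero => simp only [map_zero]
  | add x y hx hy => simp only [map_add, hx, hy]
  | @homogeneous n x =>
    have hx : Ideal.Quotient.mk I (x : R) ∈ quotGrading 𝒜 I n := ⟨x, x.2, rfl⟩
    rw [GradedAlgebra.proj_apply, GradedAlgebra.proj_apply]
    by_cases h : n = m
    · subst h
      rw [DirectSum.decompose_of_mem_same _ hx, DirectSum.decompose_of_mem_same _ x.2]
    · rw [DirectSum.decompose_of_mem_ne _ hx h, DirectSum.decompose_of_mem_ne _ x.2 h, map_zero]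

/-! ### Quasi-valuations and associated graded algebras -/

/-- A quasi-valuation on a `K`-algebra with values in a totally ordered group.  The last condition,
which holds for the quasi-valuation used below, makes the associated graded algebra unital. -/
structure QuasiValuation (K R Γ : Type*) [Field K] [CommRing R] [Algebra K R] [AddCommGroup Γ]
    [LinearOrder Γ] where
  toFun : R → WithTop Γ
  val_eq_top_iff : ∀ x, toFun x = ⊤ ↔ x = 0
  min_le_add : ∀ x y, min (toFun x) (toFun y) ≤ toFun (x + y)
  val_smul : ∀ (c : K) (x : R), c ≠ 0 → toFun (c • x) = toFun x
  add_le_mul : ∀ x y, toFun x + toFun y ≤ toFun (x * y)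
  one_nonneg : 0 ≤ toFun 1

namespace QuasiValuation

variable {K R Γ : Type*} [Field K] [CommRing R] [Algebra K R] [AddCommGroup Γ] [LinearOrder Γ]

/-- `F_{≥ a}` -/
def ge (ν : QuasiValuation K R Γ) (a : Γ) : Submodule K R where
  carrier := {x | (a : WithTop Γ) ≤ ν.toFun x}
  zero_mem' := by simp [(ν.val_eq_top_iff 0).2 rfl]
  add_mem' := fun {x y} hx hy => (le_min hx hy).trans (ν.min_le_add x y)
  smul_mem' := fun c x hx => by
    by_cases hc : c = 0
    · simp [hc, (ν.val_eq_top_iff 0).2 rfl]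
    · simpa [ν.val_smul c x hc] using hx

/-- `F_{> a}` -/
def gt (ν : QuasiValuation K R Γ) (a : Γ) : Submodule K R where
  carrier := {x | (a : WithTop Γ) < ν.toFun x}
  zero_mem' := by simp [(ν.val_eq_top_iff 0).2 rfl]
  add_mem' := fun {x y} hx hy => (lt_min hx hy).trans_le (ν.min_le_add x y)
  smul_mem' := fun c x hx => by
    by_cases hc : c = 0
    · simp [hc, (ν.val_eq_top_iff 0).2 rfl]
    · simpa [ν.val_smul c x hc] using hx

theorem one_mem_ge (ν : QuasiValuation K R Γ) : (1 : R) ∈ ν.ge 0 := ν.one_nonneg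

/-- The leaf `F_{≥ a} / F_{> a}`. -/
def Leaf (ν : QuasiValuation K R Γ) (a : Γ) : Type _ :=
  ν.ge a ⧸ (ν.gt a).submoduleOf (ν.ge a)

instance (ν : QuasiValuation K R Γ) (a : Γ) : AddCommGroup (ν.Leaf a) :=
  inferInstanceAs (AddCommGroup (ν.ge a ⧸ (ν.gt a).submoduleOf (ν.ge a)))

instance (ν : QuasiValuation K R Γ) (a : Γ) : Module K (ν.Leaf a) :=
  inferInstanceAs (Module K (ν.ge a ⧸ (ν.gt a).submoduleOf (ν.ge a)))

/-- The class of `x ∈ F_{≥ a}` in the leaf. -/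
def cls (ν : QuasiValuation K R Γ) (a : Γ) : ν.ge a →ₗ[K] ν.Leaf a :=
  ((ν.gt a).submoduleOf (ν.ge a)).mkQ

theorem cls_surjective (ν : QuasiValuation K R Γ) (a : Γ) : Function.Surjective (ν.cls a) :=
  Submodule.mkQ_surjective _

theorem cls_eq_zero (ν : QuasiValuation K R Γ) (a : Γ) (x : ν.ge a) :
    ν.cls a x = 0 ↔ (x : R) ∈ ν.gt a :=
  Submodule.Quotient.mk_eq_zero _

theorem cls_congr (ν : QuasiValuation K R Γ) {a b : Γ} {x y : R} (hx : x ∈ ν.ge a)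
    (hy : y ∈ ν.ge b) (hab : a = b) (hxy : x = y) :
    (⟨a, ν.cls a ⟨x, hx⟩⟩ : GradedMonoid ν.Leaf) = ⟨b, ν.cls b ⟨y, hy⟩⟩ := by
  subst hab; subst hxy; rfl

theorem smul_cls_one (ν : QuasiValuation K R Γ) (c : K) :
    (c • ν.cls 0 ⟨1, ν.one_mem_ge⟩ : ν.Leaf 0) =
      ν.cls 0 ⟨c • (1 : R), (ν.ge 0).smul_mem c ν.one_mem_ge⟩ :=
  ((ν.cls 0).map_smul c ⟨1, ν.one_mem_ge⟩).symm

variable [IsOrderedAddMonoid Γ]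

theorem mul_mem_ge (ν : QuasiValuation K R Γ) {a b : Γ} {x y : R} (hx : x ∈ ν.ge a)
    (hy : y ∈ ν.ge b) : x * y ∈ ν.ge (a + b) := by
  show ((a + b : Γ) : WithTop Γ) ≤ _
  rw [WithTop.coe_add]
  exact (add_le_add hx hy).trans (ν.add_le_mul x y)

theorem mul_mem_gt (ν : QuasiValuation K R Γ) {a b : Γ} {x y : R} (hx : x ∈ ν.gt a)
    (hy : y ∈ ν.ge b) : x * y ∈ ν.gt (a + b) := by
  show ((a + b : Γ) : WithTop Γ) < _
  rw [WithTop.coe_add]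
  refine lt_of_lt_of_le ?_ (ν.add_le_mul x y)
  refine lt_of_lt_of_le ?_ (add_le_add le_rfl hy)
  exact WithTop.add_lt_add_right WithTop.coe_ne_top hx

/-- The multiplication `F_{≥ a} × F_{≥ b} → F_{≥ a + b}`. -/
def mulGe (ν : QuasiValuation K R Γ) (a b : Γ) : ν.ge a →ₗ[K] ν.ge b →ₗ[K] ν.ge (a + b) :=
  LinearMap.mk₂ K (fun x y => ⟨x.1 * y.1, ν.mul_mem_ge x.2 y.2⟩)
    (fun _ _ _ => Subtype.ext (add_mul _ _ _)) (fun _ _ _ => Subtype.ext (smul_mul_assoc _ _ _))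
    (fun _ _ _ => Subtype.ext (mul_add _ _ _)) (fun _ _ _ => Subtype.ext (mul_smul_comm _ _ _))

/-- The multiplication of leaves: the class of `x` times the class of `y` is the class of `xy`. -/
def mulLeaf (ν : QuasiValuation K R Γ) (a b : Γ) :
    ν.Leaf a →ₗ[K] ν.Leaf b →ₗ[K] ν.Leaf (a + b) :=
  Submodule.liftQ ((ν.gt a).submoduleOf (ν.ge a))
    (LinearMap.flip (Submodule.liftQ ((ν.gt b).submoduleOf (ν.ge b))
      (((ν.mulGe a b).compr₂ (ν.cls (a + b))).flip) (fun y hy => LinearMap.ext fun x =>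
        (ν.cls_eq_zero _ _).2 (by
          have h := ν.mul_mem_gt (show (y : R) ∈ ν.gt b from hy) x.2
          rw [mul_comm, add_comm] at h
          exact h))))
    (fun x hx => LinearMap.ext fun y => by
      obtain ⟨y, rfl⟩ := ν.cls_surjective b y
      exact (ν.cls_eq_zero _ _).2 (ν.mul_mem_gt (show (x : R) ∈ ν.gt a from hx) y.2))

theorem mulLeaf_cls (ν : QuasiValuation K R Γ) (a b : Γ) (x : ν.ge a) (y : ν.ge b) :
    ν.mulLeaf a b (ν.cls a x) (ν.cls b y) =
      ν.cls (a + b) ⟨x.1 * y.1, ν.mul_mem_ge x.2 y.2⟩ := rfl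

instance (ν : QuasiValuation K R Γ) : GradedMonoid.GMul ν.Leaf where
  mul {a b} x y := ν.mulLeaf a b x y

instance (ν : QuasiValuation K R Γ) : GradedMonoid.GOne ν.Leaf where
  one := ν.cls 0 ⟨1, ν.one_mem_ge⟩

instance (ν : QuasiValuation K R Γ) : DirectSum.GCommRing ν.Leaf where
  one_mul := by
    rintro ⟨a, x⟩
    obtain ⟨x, rfl⟩ := ν.cls_surjective a x
    exact ν.cls_congr _ _ (zero_add _) (one_mul _)
  mul_one := by
    rintro ⟨a, x⟩
    obtain ⟨x, rfl⟩ := ν.cls_surjective a x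
    exact ν.cls_congr _ _ (add_zero _) (mul_one _)
  mul_assoc := by
    rintro ⟨a, x⟩ ⟨b, y⟩ ⟨c, z⟩
    obtain ⟨x, rfl⟩ := ν.cls_surjective a x
    obtain ⟨y, rfl⟩ := ν.cls_surjective b y
    obtain ⟨z, rfl⟩ := ν.cls_surjective c z
    exact ν.cls_congr _ _ (add_assoc _ _ _) (mul_assoc _ _ _)
  mul_comm := by
    rintro ⟨a, x⟩ ⟨b, y⟩
    obtain ⟨x, rfl⟩ := ν.cls_surjective a x
    obtain ⟨y, rfl⟩ := ν.cls_surjective b y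
    exact ν.cls_congr _ _ (add_comm _ _) (mul_comm _ _)
  mul_zero := fun x => map_zero _
  zero_mul := fun x => LinearMap.map_zero₂ _ _
  mul_add := fun x y z => map_add _ _ _
  add_mul := fun x y z => LinearMap.map_add₂ _ _ _ _
  natCast := fun n => n • ν.cls 0 ⟨1, ν.one_mem_ge⟩
  natCast_zero := zero_smul _ _
  natCast_succ := fun n => succ_nsmul _ _
  intCast := fun n => n • ν.cls 0 ⟨1, ν.one_mem_ge⟩
  intCast_ofNat := fun n => natCast_zsmul _ _
  intCast_negSucc_ofNat := fun n => negSucc_zsmul _ _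

instance (ν : QuasiValuation K R Γ) : DirectSum.GAlgebra K ν.Leaf where
  toFun := ((LinearMap.toSpanSingleton K (ν.Leaf 0) (ν.cls 0 ⟨1, ν.one_mem_ge⟩)).toAddMonoidHom)
  map_one := one_smul K (ν.cls 0 ⟨1, ν.one_mem_ge⟩)
  map_mul := by
    intro r s
    have h := ν.smul_cls_one
    show (⟨0, (r * s) • ν.cls 0 ⟨1, ν.one_mem_ge⟩⟩ : GradedMonoid ν.Leaf) =
      ⟨0 + 0, ν.mulLeaf 0 0 (r • ν.cls 0 ⟨1, ν.one_mem_ge⟩) (s • ν.cls 0 ⟨1, ν.one_mem_ge⟩)⟩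
    rw [h, h, h]
    exact ν.cls_congr _ _ (add_zero _).symm (by simp [mul_smul, smul_comm r s])
  commutes := by
    rintro r ⟨a, x⟩
    obtain ⟨x, rfl⟩ := ν.cls_surjective a x
    have h := ν.smul_cls_one
    show (⟨0 + a, ν.mulLeaf 0 a (r • ν.cls 0 ⟨1, ν.one_mem_ge⟩) (ν.cls a x)⟩ :
      GradedMonoid ν.Leaf) = ⟨a + 0, ν.mulLeaf a 0 (ν.cls a x) (r • ν.cls 0 ⟨1, ν.one_mem_ge⟩)⟩
    rw [h]
    exact ν.cls_congr _ _ (add_comm _ _) (mul_comm _ _)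
  smul_def := by
    rintro r ⟨a, x⟩
    obtain ⟨x, rfl⟩ := ν.cls_surjective a x
    have h := ν.smul_cls_one
    show (⟨a, r • ν.cls a x⟩ : GradedMonoid ν.Leaf) =
      ⟨0 + a, ν.mulLeaf 0 a (r • ν.cls 0 ⟨1, ν.one_mem_ge⟩) (ν.cls a x)⟩
    rw [h, ← (ν.cls a).map_smul r x]
    exact ν.cls_congr _ _ (zero_add _).symm (by simp)

/-- The associated graded algebra `gr_ν R = ⨁_a F_{≥ a} / F_{> a}`. -/
def Gr (ν : QuasiValuation K R Γ) : Type _ := DirectSum Γ ν.Leaf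

instance (ν : QuasiValuation K R Γ) : CommRing ν.Gr :=
  inferInstanceAs (CommRing (DirectSum Γ ν.Leaf))

instance (ν : QuasiValuation K R Γ) : Algebra K ν.Gr :=
  inferInstanceAs (Algebra K (DirectSum Γ ν.Leaf))

/-- The inclusion of a leaf into `gr_ν R`. -/
def ofLeaf (ν : QuasiValuation K R Γ) (a : Γ) : ν.Leaf a →ₗ[K] ν.Gr :=
  DirectSum.lof K Γ ν.Leaf a

theorem ofLeaf_mul (ν : QuasiValuation K R Γ) (a b : Γ) (x : ν.ge a) (y : ν.ge b) :
    ν.ofLeaf a (ν.cls a x) * ν.ofLeaf b (ν.cls b y) =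
      ν.ofLeaf (a + b) (ν.cls (a + b) ⟨x.1 * y.1, ν.mul_mem_ge x.2 y.2⟩) :=
  DirectSum.of_mul_of (A := ν.Leaf) _ _

/-- The reduced algebra `Red(gr_ν R)`. -/
def RedGr (ν : QuasiValuation K R Γ) : Type _ := ν.Gr ⧸ nilradical ν.Gr

instance (ν : QuasiValuation K R Γ) : CommRing ν.RedGr :=
  inferInstanceAs (CommRing (ν.Gr ⧸ nilradical ν.Gr))

instance (ν : QuasiValuation K R Γ) : Algebra K ν.RedGr :=
  inferInstanceAs (Algebra K (ν.Gr ⧸ nilradical ν.Gr))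

/-- For a grading of `R`, the part of degree `m` of `gr_ν R`: it is spanned by the classes of the
elements of `R` which are homogeneous of degree `m`. -/
def grGrading (ν : QuasiValuation K R Γ) (𝒜 : ℕ → Submodule K R) (m : ℕ) : Submodule K ν.Gr :=
  Submodule.span K {z | ∃ (a : Γ) (x : ν.ge a), (x : R) ∈ 𝒜 m ∧
    z = ν.ofLeaf a (ν.cls a x)}

/-- If the filtration is compatible with the grading of `R`, then `gr_ν R` is graded. -/
@[reducible] def grGradedAlgebra (ν : QuasiValuation K R Γ) (𝒜 : ℕ → Submodule K R) [GradedAlgebra 𝒜]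
    (hν : ∀ m x, ν.toFun x ≤ ν.toFun (GradedAlgebra.proj 𝒜 m x)) :
    GradedAlgebra (ν.grGrading 𝒜) :=
  haveI : SetLike.GradedMonoid (ν.grGrading 𝒜) :=
    { one_mem := Submodule.subset_span
        ⟨0, ⟨1, ν.one_mem_ge⟩, SetLike.GradedOne.one_mem, rfl⟩
      mul_mem := by
        intro i j z w hz hw
        have h := Submodule.mul_mem_mul hz hw
        rw [grGrading, grGrading, Submodule.span_mul_span] at h
        refine Submodule.span_mono ?_ h
        rintro _ ⟨_, ⟨a, x, hx, rfl⟩, _, ⟨b, y, hy, rfl⟩, rfl⟩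
        exact ⟨a + b, ⟨x.1 * y.1, ν.mul_mem_ge x.2 y.2⟩, SetLike.GradedMul.mul_mem hx hy,
          ν.ofLeaf_mul a b x y⟩ }
  { DirectSum.IsInternal.chooseDecomposition (ν.grGrading 𝒜) <| by
      let p : ∀ (m : ℕ) (a : Γ), ν.Leaf a →ₗ[K] ν.Leaf a := fun m a =>
        Submodule.mapQ _ _ ((GradedAlgebra.proj 𝒜 m).restrict
          (p := ν.ge a) (q := ν.ge a) (fun x hx => le_trans hx (hν m x)))
          (fun x hx =>             (lt_of_lt_of_le (show (a : WithTop Γ) < ν.toFun x from hx) (hν m x)))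
      have hp : ∀ m a (x : ν.ge a), p m a (ν.cls a x) =
          ν.cls a ⟨GradedAlgebra.proj 𝒜 m x, le_trans x.2 (hν m x)⟩ := fun m a x => rfl
      let π : ℕ → ν.Gr →ₗ[K] ν.Gr := fun m =>
        (DirectSum.lmap (p m) : DirectSum Γ ν.Leaf →ₗ[K] DirectSum Γ ν.Leaf)
      have hπ : ∀ m a (x : ν.ge a), π m (ν.ofLeaf a (ν.cls a x)) =
          ν.ofLeaf a (ν.cls a ⟨GradedAlgebra.proj 𝒜 m x, le_trans x.2 (hν m x)⟩) := by
        intro m a x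
        rw [← hp]
        exact DirectSum.lmap_lof (p m) a (ν.cls a x)
      refine isInternal_of_proj _ π ?_ ?_ ?_
      · intro m z hz
        induction hz using Submodule.span_induction with
        | mem z hz =>
          obtain ⟨a, x, hx, rfl⟩ := hz
          rw [hπ]
          congr 3
          rw [GradedAlgebra.proj_apply, DirectSum.decompose_of_mem_same _ hx]
        | zero => exact map_zero _
        | add x y _ _ hx hy => rw [map_add, hx, hy]
        | smul c x _ hx => rw [map_smul, hx]
      · intro m n hmn z hz
        induction hz using Submodule.span_induction with
        | mem z hz =>
          obtain ⟨a, x, hx, rfl⟩ := hz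
          have h0 : (⟨GradedAlgebra.proj 𝒜 m x, le_trans x.2 (hν m x)⟩ : ν.ge a) = 0 := by
            ext
            exact DirectSum.decompose_of_mem_ne _ hx hmn.symm
          rw [hπ, h0, map_zero, map_zero]
        | zero => exact map_zero _
        | add x y _ _ hx hy => rw [map_add, hx, hy, add_zero]
        | smul c x _ hx => rw [map_smul, hx, smul_zero]
      · classical
        rw [eq_top_iff]
        rintro z -
        refine DirectSum.induction_on (motive := fun z : DirectSum Γ ν.Leaf =>
          (show ν.Gr from z) ∈ ⨆ m, ν.grGrading 𝒜 m) z ?_ ?_ ?_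
        · exact Submodule.zero_mem _
        · intro a z
          show ν.ofLeaf a z ∈ _
          obtain ⟨x, rfl⟩ := ν.cls_surjective a z
          have hx : x = ∑ m ∈ (DirectSum.decompose 𝒜 (x : R)).support,
              (⟨GradedAlgebra.proj 𝒜 m x, le_trans x.2 (hν m x)⟩ : ν.ge a) := by
            ext
            rw [Submodule.coe_sum]
            exact (DirectSum.sum_support_decompose 𝒜 (x : R)).symm
          rw [hx, map_sum, map_sum]
          refine Submodule.sum_mem _ fun m _ => ?_
          refine Submodule.mem_iSup_of_mem m (Submodule.subset_span ⟨a, _, ?_, rfl⟩)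
          exact SetLike.coe_mem _
        · intro x y hx hy
          exact Submodule.add_mem _ hx hy with }

/-- The grading of `Red(gr_ν R)` induced by a grading of `R`. -/
def redGrGrading (ν : QuasiValuation K R Γ) (𝒜 : ℕ → Submodule K R) (m : ℕ) :
    Submodule K ν.RedGr :=
  quotGrading (ν.grGrading 𝒜) (nilradical ν.Gr) m

/-- `Red(gr_ν R)` is graded: the nilradical is a homogeneous ideal. -/
@[reducible] def redGrGradedAlgebra (ν : QuasiValuation K R Γ) (𝒜 : ℕ → Submodule K R) [GradedAlgebra 𝒜]
    (hν : ∀ m x, ν.toFun x ≤ ν.toFun (GradedAlgebra.proj 𝒜 m x)) :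
    GradedAlgebra (ν.redGrGrading 𝒜) :=
  letI := ν.grGradedAlgebra 𝒜 hν
  quotGradedAlgebra (ν.grGrading 𝒜) (nilradical ν.Gr)
    ((Ideal.IsHomogeneous.bot (ν.grGrading 𝒜)).radical)

end QuasiValuation

/-! ### The embedded toric variety -/

section Toric

attribute [local instance] MvPolynomial.gradedAlgebra

variable {d : ℕ} (K : Type u) [Field K] (A : Finset (Fin d → ℤ))

/-- The map `(c, t) ↦ ∑_χ c χ(t) e_χ` from the torus `Kˣ × (Kˣ)^d` to `K^A`. -/
def torusMap (z : Kˣ × (Fin d → Kˣ)) : A → K :=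
  fun χ => ((z.1 * ∏ i, z.2 i ^ (χ.1 i) : Kˣ) : K)

/-- The affine cone over the embedded toric variety `X_A ⊆ ℙ(K^A)`: the Zariski closure of the
image of the torus in `K^A`. -/
def affineCone : Set (A → K) :=
  MvPolynomial.zeroLocus K (MvPolynomial.vanishingIdeal K (Set.range (torusMap K A)))

/-- The vanishing ideal of the affine cone, i.e. the homogeneous ideal of `X_A`. -/
def toricIdeal : Ideal (MvPolynomial A K) := MvPolynomial.vanishingIdeal K (affineCone K A)

/-- The coordinate ring of the affine cone, i.e. the homogeneous coordinate ring of `X_A`. -/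
abbrev CoordRing : Type u := MvPolynomial A K ⧸ toricIdeal K A

/-- The grading of the homogeneous coordinate ring by degree. -/
def coordGrading (m : ℕ) : Submodule K (CoordRing K A) :=
  quotGrading (MvPolynomial.homogeneousSubmodule A K) (toricIdeal K A) m

theorem mem_toricIdeal {p : MvPolynomial A K} :
    p ∈ toricIdeal K A ↔ ∀ z, MvPolynomial.aeval (torusMap K A z) p = 0 := by
  have h : toricIdeal K A = MvPolynomial.vanishingIdeal K (Set.range (torusMap K A)) :=
    le_antisymm
      (MvPolynomial.vanishingIdeal_anti_mono (MvPolynomial.zeroLocus_vanishingIdeal_le _))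
      (MvPolynomial.le_vanishingIdeal_zeroLocus _)
  rw [h, MvPolynomial.mem_vanishingIdeal_iff]
  exact Set.forall_mem_range

theorem toricIdeal_isHomogeneous [Infinite K] :
    (toricIdeal K A).IsHomogeneous (MvPolynomial.homogeneousSubmodule A K) := by
  intro m p hp
  rw [mem_toricIdeal] at hp
  have hproj : ((DirectSum.decompose (MvPolynomial.homogeneousSubmodule A K) p m :
      MvPolynomial.homogeneousSubmodule A K m) : MvPolynomial A K) =
        MvPolynomial.homogeneousComponent m p :=
    MvPolynomial.decomposition.decompose'_apply p m
  rw [hproj, mem_toricIdeal]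
  intro z
  let F : Polynomial K := ∑ i ∈ Finset.range (p.totalDegree + 1),
    Polynomial.monomial i (MvPolynomial.aeval (torusMap K A z)
      (MvPolynomial.homogeneousComponent i p))
  have hF : F = 0 := by
    refine Polynomial.eq_zero_of_infinite_isRoot F (Set.Infinite.mono (s := {0}ᶜ) ?_
      (Set.finite_singleton (0 : K)).infinite_compl)
    intro c hc
    have h0 := hp (Units.mk0 c hc * z.1, z.2)
    have hsc : torusMap K A (Units.mk0 c hc * z.1, z.2) = c • torusMap K A z := by
      ext χ
      show _ = c * _
      simp only [torusMap, Units.val_mul, mul_assoc]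
      rfl
    rw [hsc, ← MvPolynomial.sum_homogeneousComponent p, map_sum] at h0
    show Polynomial.eval c F = 0
    rw [Polynomial.eval_finsetSum, ← h0]
    refine Finset.sum_congr rfl fun i _ => ?_
    rw [Polynomial.eval_monomial, MvPolynomial.aeval_def, MvPolynomial.aeval_def,
      MvPolynomial.eval₂_eq, MvPolynomial.eval₂_eq, Finset.sum_mul]
    refine Finset.sum_congr rfl fun α hα => ?_
    have hdeg : α.degree = i := by
      rw [MvPolynomial.support_homogeneousComponent, Finset.mem_filter] at hα
      exact hα.2
    rw [Finsupp.degree_apply] at hdeg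
    simp only [Pi.smul_apply, smul_eq_mul, mul_pow, Finset.prod_mul_distrib,
      Finset.prod_pow_eq_pow_sum, hdeg]
    ring
  by_cases hm : m ∈ Finset.range (p.totalDegree + 1)
  · have := congrArg (fun G => Polynomial.coeff G m) hF
    simpa [F, Polynomial.finsetSum_coeff, Polynomial.coeff_monomial, Finset.mem_range.1 hm]
      using this
  · rw [MvPolynomial.homogeneousComponent_eq_zero, map_zero]
    simpa using hm

instance [Infinite K] : GradedAlgebra (coordGrading K A) :=
  quotGradedAlgebra _ _ (toricIdeal_isHomogeneous K A)

/-! ### The quasi-valuation of a weighting matrix -/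

variable {K A} {N : ℕ} (Ψ : Matrix (Fin N) A ℚ)

/-- The value `Ψ · α` of the monomial `x^α`, in `ℚ^N` with the lexicographic order. -/
def weight (α : A →₀ ℕ) : Lex (Fin N → ℚ) := toLex (Ψ.mulVec fun χ => (α χ : ℚ))

/-- The valuation `p ↦ min {Ψ · α ∣ x^α occurs in p}` of the polynomial ring. -/
def weightVal (p : MvPolynomial A K) : WithTop (Lex (Fin N → ℚ)) :=
  p.support.inf fun α => (weight Ψ α : WithTop (Lex (Fin N → ℚ)))

theorem weight_add (α β : A →₀ ℕ) : weight Ψ (α + β) = weight Ψ α + weight Ψ β := by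
  have h : (fun χ => ((α + β) χ : ℚ)) = (fun χ => (α χ : ℚ)) + fun χ => (β χ : ℚ) := by
    ext χ
    simp
  rw [weight, weight, weight, h, Matrix.mulVec_add, toLex_add]

theorem le_weightVal {p : MvPolynomial A K} {a : WithTop (Lex (Fin N → ℚ))} :
    a ≤ weightVal Ψ p ↔ ∀ α, p.coeff α ≠ 0 → a ≤ weight Ψ α := by
  simp [weightVal, Finset.le_inf_iff]

theorem weightVal_le {p : MvPolynomial A K} {α : A →₀ ℕ} (h : p.coeff α ≠ 0) :
    weightVal Ψ p ≤ weight Ψ α := (le_weightVal Ψ).1 le_rfl α h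

theorem weightVal_eq_top {p : MvPolynomial A K} : weightVal Ψ p = ⊤ ↔ p = 0 := by
  constructor
  · intro h
    ext α
    by_contra hα
    exact WithTop.coe_ne_top (top_le_iff.1 (h ▸ weightVal_le Ψ hα))
  · rintro rfl
    simp [weightVal]

theorem weightVal_add (p q : MvPolynomial A K) :
    min (weightVal Ψ p) (weightVal Ψ q) ≤ weightVal Ψ (p + q) := by
  rw [le_weightVal]
  intro α hα
  by_cases hp : p.coeff α = 0
  · refine (min_le_right _ _).trans (weightVal_le Ψ fun hq => hα ?_)
    rw [MvPolynomial.coeff_add, hp, hq, add_zero]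
  · exact (min_le_left _ _).trans (weightVal_le Ψ hp)

theorem weightVal_mul (p q : MvPolynomial A K) :
    weightVal Ψ p + weightVal Ψ q ≤ weightVal Ψ (p * q) := by
  classical
  rw [le_weightVal]
  intro α hα
  rw [MvPolynomial.coeff_mul] at hα
  obtain ⟨⟨β, γ⟩, hβγ, h⟩ := Finset.exists_ne_zero_of_sum_ne_zero hα
  rw [← Finset.HasAntidiagonal.mem_antidiagonal.1 hβγ, weight_add, WithTop.coe_add]
  exact add_le_add (weightVal_le Ψ (left_ne_zero_of_mul h)) (weightVal_le Ψ (right_ne_zero_of_mul h))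

theorem weightVal_smul (c : K) (p : MvPolynomial A K) (hc : c ≠ 0) :
    weightVal Ψ (c • p) = weightVal Ψ p := by
  refine eq_of_forall_le_iff fun a => ?_
  simp [le_weightVal, MvPolynomial.coeff_smul, hc]

theorem weightVal_homogeneousComponent (m : ℕ) (p : MvPolynomial A K) :
    weightVal Ψ p ≤ weightVal Ψ (MvPolynomial.homogeneousComponent m p) := by
  rw [le_weightVal]
  intro α hα
  rw [MvPolynomial.coeff_homogeneousComponent] at hα
  exact weightVal_le Ψ fun h => hα (by simp [h])

theorem exists_isGreatest_weightVal [Infinite K] (f : CoordRing K A) :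
    ∃ a, IsGreatest {b | ∃ p : MvPolynomial A K,
      Ideal.Quotient.mk (toricIdeal K A) p = f ∧ weightVal Ψ p = b} a := by
  classical
  obtain ⟨p₀, rfl⟩ := Ideal.Quotient.mk_surjective f
  set B : Set (WithTop (Lex (Fin N → ℚ))) := {b | ∃ p : MvPolynomial A K,
    Ideal.Quotient.mk (toricIdeal K A) p = Ideal.Quotient.mk (toricIdeal K A) p₀ ∧
      weightVal Ψ p = b} with hB
  let D := p₀.totalDegree
  let F : Set (WithTop (Lex (Fin N → ℚ))) :=
    insert ⊤ ((fun α => (weight Ψ α : WithTop (Lex (Fin N → ℚ)))) '' {α | α.degree ≤ D})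
  have hF : F.Finite := ((Finsupp.finite_of_degree_le D).image _).insert ⊤
  have key : ∀ b ∈ B, ∃ b' ∈ B ∩ F, b ≤ b' := by
    rintro _ ⟨p, hp, rfl⟩
    let p' := ∑ m ∈ Finset.range (D + 1), MvPolynomial.homogeneousComponent m p
    have hco : ∀ α, p'.coeff α ≠ 0 → α.degree ≤ D ∧ p.coeff α ≠ 0 := by
      intro α hα
      rw [MvPolynomial.coeff_sum] at hα
      obtain ⟨m, hm, h⟩ := Finset.exists_ne_zero_of_sum_ne_zero hα
      rw [MvPolynomial.coeff_homogeneousComponent] at h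
      by_cases hd : α.degree = m
      · rw [if_pos hd] at h
        exact ⟨by rw [hd]; exact Nat.lt_succ_iff.1 (Finset.mem_range.1 hm), h⟩
      · exact absurd (if_neg hd) h
    refine ⟨weightVal Ψ p', ⟨⟨p', ?_, rfl⟩, ?_⟩, ?_⟩
    · rw [Ideal.Quotient.mk_eq_mk_iff_sub_mem] at hp ⊢
      have h : p' - p₀ =
          ∑ m ∈ Finset.range (D + 1), MvPolynomial.homogeneousComponent m (p - p₀) := by
        conv_lhs => rw [← MvPolynomial.sum_homogeneousComponent p₀]
        simp only [map_sub, Finset.sum_sub_distrib]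
        rfl
      rw [h]
      exact Ideal.sum_mem _ fun m _ => MvPolynomial.homogeneousComponent_mem_of_mem
        (toricIdeal_isHomogeneous K A) hp m
    · by_cases h0 : p' = 0
      · exact Or.inl ((weightVal_eq_top Ψ).2 h0)
      · obtain ⟨α, hα, h⟩ := Finset.exists_mem_eq_inf p'.support
          (MvPolynomial.support_nonempty.2 h0)
          (fun α => (weight Ψ α : WithTop (Lex (Fin N → ℚ))))
        exact Or.inr ⟨α, (hco α (MvPolynomial.mem_support_iff.1 hα)).1, h.symm⟩
    · rw [le_weightVal]
      exact fun α hα => weightVal_le Ψ (hco α hα).2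
  obtain ⟨b₀, hb₀, -⟩ := key (weightVal Ψ p₀) ⟨p₀, rfl, rfl⟩
  obtain ⟨a, ha, hmax⟩ := Set.exists_max_image (B ∩ F) id (hF.subset Set.inter_subset_right)
    ⟨b₀, hb₀⟩
  refine ⟨a, ha.1, fun b hb => ?_⟩
  obtain ⟨b', hb', hle⟩ := key b hb
  exact hle.trans (hmax b' hb')

/-- The push-forward of `weightVal Ψ` to `K[X̂_A]`:
`ν_Ψ(f) = max {weightVal Ψ p ∣ p` a polynomial with image `f}`. -/
def nuVal [Infinite K] (f : CoordRing K A) : WithTop (Lex (Fin N → ℚ)) :=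
  (exists_isGreatest_weightVal Ψ f).choose

theorem nuVal_isGreatest [Infinite K] (f : CoordRing K A) :
    IsGreatest {b | ∃ p : MvPolynomial A K,
      Ideal.Quotient.mk (toricIdeal K A) p = f ∧ weightVal Ψ p = b} (nuVal Ψ f) :=
  (exists_isGreatest_weightVal Ψ f).choose_spec

theorem exists_lift [Infinite K] (f : CoordRing K A) : ∃ p : MvPolynomial A K,
    Ideal.Quotient.mk (toricIdeal K A) p = f ∧ weightVal Ψ p = nuVal Ψ f :=
  (nuVal_isGreatest Ψ f).1

theorem le_nuVal [Infinite K] (p : MvPolynomial A K) :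
    weightVal Ψ p ≤ nuVal Ψ (Ideal.Quotient.mk (toricIdeal K A) p) :=
  (nuVal_isGreatest Ψ _).2 ⟨p, rfl, rfl⟩

/-- The quasi-valuation `ν_Ψ` induced by the weighting matrix `Ψ`. -/
def nu [Infinite K] : QuasiValuation K (CoordRing K A) (Lex (Fin N → ℚ)) where
  toFun := nuVal Ψ
  val_eq_top_iff := fun f => by
    obtain ⟨p, rfl, hp⟩ := exists_lift Ψ f
    constructor
    · intro h
      rw [h, weightVal_eq_top] at hp
      rw [hp, map_zero]
    · intro h
      rw [h, ← map_zero (Ideal.Quotient.mk (toricIdeal K A)), ← top_le_iff]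
      exact ((weightVal_eq_top Ψ).2 rfl).ge.trans (le_nuVal Ψ 0)
  min_le_add := fun f g => by
    obtain ⟨p, rfl, hp⟩ := exists_lift Ψ f
    obtain ⟨q, rfl, hq⟩ := exists_lift Ψ g
    rw [← hp, ← hq, ← map_add]
    exact (weightVal_add Ψ p q).trans (le_nuVal Ψ _)
  val_smul := fun c f hc => by
    have key : ∀ (c : K) (f : CoordRing K A), c ≠ 0 → nuVal Ψ f ≤ nuVal Ψ (c • f) := by
      intro c f hc
      obtain ⟨p, rfl, hp⟩ := exists_lift Ψ f
      rw [← hp, ← weightVal_smul Ψ c p hc]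
      exact le_nuVal Ψ _
    refine le_antisymm ?_ (key c f hc)
    simpa [smul_smul, inv_mul_cancel₀ hc] using key c⁻¹ (c • f) (inv_ne_zero hc)
  add_le_mul := fun f g => by
    obtain ⟨p, rfl, hp⟩ := exists_lift Ψ f
    obtain ⟨q, rfl, hq⟩ := exists_lift Ψ g
    rw [← hp, ← hq, ← map_mul]
    exact (weightVal_mul Ψ p q).trans (le_nuVal Ψ _)
  one_nonneg := by
    rw [← map_one (Ideal.Quotient.mk (toricIdeal K A))]
    refine le_trans ((le_weightVal Ψ).2 ?_) (le_nuVal Ψ 1)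
    intro α hα
    rw [MvPolynomial.coeff_one] at hα
    have : α = 0 := by by_contra h; simp [Ne.symm h] at hα
    subst this
    have h0 : weight Ψ (0 : A →₀ ℕ) = 0 := by
      have := weight_add Ψ (0 : A →₀ ℕ) 0
      simpa using this
    simp [h0]

theorem nu_proj [Infinite K] (m : ℕ) (f : CoordRing K A) :
    (nu Ψ).toFun f ≤ (nu Ψ).toFun (GradedAlgebra.proj (coordGrading K A) m f) := by
  obtain ⟨p, rfl, hp⟩ := exists_lift Ψ f
  show nuVal Ψ _ ≤ nuVal Ψ _
  have h : GradedAlgebra.proj (coordGrading K A) m (Ideal.Quotient.mk (toricIdeal K A) p) =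
      Ideal.Quotient.mk (toricIdeal K A) (MvPolynomial.homogeneousComponent m p) :=
    letI : GradedAlgebra (quotGrading (MvPolynomial.homogeneousSubmodule A K)
        (toricIdeal K A)) := inferInstanceAs (GradedAlgebra (coordGrading K A))
    (proj_quotGrading (MvPolynomial.homogeneousSubmodule A K) (toricIdeal K A) m p).trans
      (congrArg _ (MvPolynomial.decomposition.decompose'_apply p m))
  rw [h, ← hp]
  exact (weightVal_homogeneousComponent Ψ m p).trans (le_nuVal Ψ _)

/-- The grading by degree of `Red(gr_{ν_Ψ} K[X̂_A])`. -/
def nuGrading [Infinite K] : ℕ → Submodule K (nu (K := K) Ψ).RedGr :=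
  (nu (K := K) Ψ).redGrGrading (coordGrading K A)

instance [Infinite K] : GradedAlgebra (nuGrading (K := K) Ψ) :=
  (nu (K := K) Ψ).redGrGradedAlgebra (coordGrading K A) (nu_proj Ψ)

end Toric

/-! ### The toric varieties of the cells and the semi-toric variety -/

open CategoryTheory AlgebraicGeometry

/-- `Proj` of an `ℕ`-graded `K`-algebra, as a scheme over `K`. -/
def projOver (K : Type u) [Field K] {R : Type u} [CommRing R] [Algebra K R]
    (𝒜 : ℕ → Submodule K R) [GradedAlgebra 𝒜] : Over (Spec (CommRingCat.of K)) :=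
  Over.mk (Proj.toSpecZero 𝒜 ≫ Spec.map (CommRingCat.ofHom (algebraMap K (𝒜 0))))

/-- The submonoid of `ℕ × ℤ^d` generated by the points `(1, χ)` for `χ ∈ s`. -/
def cellMonoid {d : ℕ} (s : Finset (Fin d → ℤ)) : AddSubmonoid (ℕ × (Fin d → ℤ)) :=
  AddSubmonoid.closure ((fun χ => (1, χ)) '' (s : Set (Fin d → ℤ)))

/-- The degree, i.e. the first coordinate. -/
def cellDeg {d : ℕ} (s : Finset (Fin d → ℤ)) : cellMonoid s →+ ℕ :=
  (AddMonoidHom.fst ℕ (Fin d → ℤ)).comp (cellMonoid s).subtype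

/-- The variety `Proj K[S]`, where `S` is the monoid generated by `s`. -/
def cellVariety (K : Type u) [Field K] {d : ℕ} (s : Finset (Fin d → ℤ)) :
    Over (Spec (CommRingCat.of K)) :=
  projOver K (AddMonoidAlgebra.gradeBy K (cellDeg s))

/-- The embedded toric variety `X_A`, as `Proj` of its homogeneous coordinate ring. -/
def toricVariety (K : Type u) [Field K] [Infinite K] {d : ℕ} (A : Finset (Fin d → ℤ)) :
    Over (Spec (CommRingCat.of K)) :=
  projOver K (coordGrading K A)

/-- `Z_0 = Proj (Red(gr_{ν_Ψ} K[X̂_A]))`. -/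
def semiToric (K : Type u) [Field K] [Infinite K] {d N : ℕ} {A : Finset (Fin d → ℤ)}
    (Ψ : Matrix (Fin N) A ℚ) : Over (Spec (CommRingCat.of K)) :=
  projOver K (nuGrading (K := K) Ψ)

end HigherGKZ

end

/-!
Write `P = K[x_χ ∣ χ ∈ A]`. Both sides of the asserted decomposition are quotients of `P`.

For a set `s ⊆ A`, the monoid algebra `K[S]` of the monoid generated by the points `(1, χ)`, `χ ∈
s`, is the quotient of `P` by the kernel `J_s` of `cellHom`, which sends `x_χ` to the monomial of
`(1, χ)` if `χ ∈ s` and to `0` otherwise. For `s = A` this is the toric ideal, by the independence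
of the characters of the torus (`toricIdeal_eq_ker`). The algebra `Red(gr_{ν_Ψ} K[X̂_A])` is a
quotient of `P` by the map `redHom`, which sends `x_χ` to its class in degree `Ψ(χ)`. The heart of
the proof is the equality `ker redHom = ⋂_s J_s`, where `s` runs over the markings of the
subdivision (`ker_redHom_of_mem_openGKZCone`). As the right hand side does not mention `Ψ`, all
claims about `Z_0` follow from it: the quotient maps `P / ⋂ J_s → P / J_s` induce the closed
immersions, their images cover since a prime containing a finite intersection of ideals contains
one of them, and the union is irredundant since `J_t ⊆ J_s` implies `s ⊆ t`, and different
markings are not contained in each other (`eq_of_subset_of_mem_openGKZCone`). The dimension is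
read off on standard charts, whose rings are generated by Laurent monomials with exponents spanning
`ℝ^d`.

The equality rests on two facts about the subdivision.

* If `g` is the convex upward map of `Ψ` and `ψ` is the linear map which agrees with `g` on the
  cone over a cell `s`, then `Ψ(χ) ≤ g(χ) ≤ ψ(χ)` for all `χ ∈ A`, with equality exactly for `χ ∈
  s` (`exists_isSupporting`). The set where `g = ψ` is a convex domain of linearity; by the
  maximality of domains of linearity it is the polytope of `s`.
* Some nonzero multiple of the multidegree `∑ α_χ (1, χ)` of any exponent `α` is the multidegree
  of an exponent supported in a single cell (`exists_suppIn_mdeg_eq_nsmul`). This holds as the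
  polytopes of the cells cover `conv(A)` and the coordinates of a rational point with respect to
  affinely independent rational points are rational.

By the first fact the weight of an exponent `α` of multidegree `m` is at most `ψ(m)`, and equal to
it exactly if `α` is supported in `s`. Hence, if a part of weight `a` of a polynomial agrees
modulo the toric ideal with a polynomial of higher weights, it lies in `J_s`: compare the terms of
multidegree `m`; only those with `ψ(m) = a` matter, and there nothing of higher weight is left.
Conversely, two monomials of the same multidegree supported in the same cell have the same class
in the associated graded algebra, and by the second fact a monomial not supported in any cell has
a power which equals, modulo the toric ideal, a monomial of higher weight; so it is nilpotent in
the associated graded algebra.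
-/

noncomputable section

namespace HigherGKZ

universe u

/-! ### Morphisms between `Proj` of graded quotients -/

section

open CategoryTheory AlgebraicGeometry HomogeneousLocalization

section ProjOver

variable {K : Type u} [Field K] {R B C : Type u} [CommRing R] [Algebra K R] [CommRing B]
  [Algebra K B] [CommRing C] [Algebra K C]
  {𝒜 : ℕ → Submodule K R} {ℬ : ℕ → Submodule K B} {𝒞 : ℕ → Submodule K C}
  [GradedAlgebra 𝒜] [GradedAlgebra ℬ] [GradedAlgebra 𝒞]

/-- A degree preserving algebra homomorphism as a homomorphism of graded rings. -/
def gradedHom (f : R →ₐ[K] B) (hf : ∀ i, ∀ x ∈ 𝒜 i, f x ∈ ℬ i) : 𝒜 →+*ᵍ ℬ :=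
  { (f : R →+* B) with map_mem := fun {i x} hx => hf i x hx }

/-- A surjective degree preserving homomorphism is surjective in each degree. -/
theorem exists_mem_of_surjective (f : R →ₐ[K] B) (hf : ∀ i, ∀ x ∈ 𝒜 i, f x ∈ ℬ i)
    (hs : Function.Surjective f) {i : ℕ} {y : B} (hy : y ∈ ℬ i) : ∃ x ∈ 𝒜 i, f x = y := by
  obtain ⟨x, rfl⟩ := hs y
  refine ⟨(DirectSum.decompose 𝒜 x i : R), SetLike.coe_mem _, ?_⟩
  have h2 := (gradedHom f hf).map_directSumDecompose (x := x) (i := i)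
  exact h2.trans (DirectSum.decompose_of_mem_same ℬ hy)

/-- A surjection of graded algebras satisfies the condition under which a graded homomorphism
induces a morphism defined on all of `Proj`. -/
theorem irrelevant_le_map (f : R →ₐ[K] B) (hf : ∀ i, ∀ x ∈ 𝒜 i, f x ∈ ℬ i)
    (hs : Function.Surjective f) :
    HomogeneousIdeal.irrelevant ℬ ≤
      (HomogeneousIdeal.irrelevant 𝒜).map (gradedHom f hf) := by
  rw [HomogeneousIdeal.irrelevant_le]
  intro i hi y hy
  obtain ⟨x, hx, rfl⟩ := exists_mem_of_surjective f hf hs hy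
  exact Ideal.mem_map_of_mem (gradedHom f hf)
    (HomogeneousIdeal.mem_irrelevant_of_mem 𝒜 hi hx)

/-- Compatibility with the structure morphisms to `Spec K`, on a basic open set. -/
theorem awayι_map_toSpec (f : R →ₐ[K] B) (hf : ∀ i, ∀ x ∈ 𝒜 i, f x ∈ ℬ i)
    (hs : Function.Surjective f) {i : ℕ} (hi : 0 < i) (s : R) (h : s ∈ 𝒜 i) :
    Proj.awayι ℬ (gradedHom f hf s) ((gradedHom f hf).2 h) hi ≫
        Proj.map (gradedHom f hf) (irrelevant_le_map f hf hs) ≫ (projOver K 𝒜).hom =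
      Proj.awayι ℬ (gradedHom f hf s) ((gradedHom f hf).2 h) hi ≫ (projOver K ℬ).hom := by
  simp only [projOver, Over.mk_hom]
  rw [Proj.awayι_comp_map_assoc _ _ hi _ h, Proj.awayι_toSpecZero_assoc,
    Proj.awayι_toSpecZero_assoc, ← Spec.map_comp, ← Spec.map_comp, ← Spec.map_comp]
  congr 1
  ext x
  have hx : gradedHom f hf (algebraMap K R x) = algebraMap K B x := f.commutes x
  show Localization.mk (gradedHom f hf (algebraMap K R x))
      (⟨gradedHom f hf 1, _⟩ : Submonoid.powers (gradedHom f hf s)) =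
    Localization.mk (algebraMap K B x) (⟨1, _⟩ : Submonoid.powers (gradedHom f hf s))
  congr 1
  exact Subtype.ext (map_one _)

/-- The morphism of schemes over `K` induced by a surjective homomorphism of graded algebras. -/
def projMap (f : R →ₐ[K] B) (hf : ∀ i, ∀ x ∈ 𝒜 i, f x ∈ ℬ i) (hs : Function.Surjective f) :
    projOver K ℬ ⟶ projOver K 𝒜 :=
  Over.homMk (Proj.map (gradedHom f hf) (irrelevant_le_map f hf hs)) <|
    (Proj.mapAffineOpenCover (gradedHom f hf)
      (irrelevant_le_map f hf hs)).openCover.hom_ext _ _ fun s =>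
        awayι_map_toSpec f hf hs s.1.2 s.2 s.2.2

/-- On basic opens the surjection induces surjections of the degree zero localizations. -/
theorem awayMap_surjective (f : R →ₐ[K] B) (hf : ∀ i, ∀ x ∈ 𝒜 i, f x ∈ ℬ i)
    (hs : Function.Surjective f) {i : ℕ} {s : R} (h : s ∈ 𝒜 i) :
    Function.Surjective (Away.map (gradedHom f hf) s) := by
  intro y
  obtain ⟨n, b, hb, rfl⟩ := y.mk_surjective _ ((gradedHom f hf).2 h)
  obtain ⟨a, ha, rfl⟩ := exists_mem_of_surjective f hf hs hb
  exact ⟨Away.mk 𝒜 h n a ha, Away.map_mk (gradedHom f hf) s h n a ha⟩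

theorem isClosedImmersion_map_restrict (f : R →ₐ[K] B) (hf : ∀ i, ∀ x ∈ 𝒜 i, f x ∈ ℬ i)
    (hs : Function.Surjective f) {i : ℕ} (hi : 0 < i) (s : R) (h : s ∈ 𝒜 i) :
    IsClosedImmersion ((Proj.map (gradedHom f hf) (irrelevant_le_map f hf hs)) ∣_
      (Proj.basicOpen 𝒜 s)) := by
  let e : (Proj.basicOpen ℬ (gradedHom f hf s)).toScheme ≅
      Spec (CommRingCat.of (Away ℬ (gradedHom f hf s))) :=
    Proj.basicOpenIsoSpec ℬ (gradedHom f hf s) ((gradedHom f hf).2 h) hi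
  let e' : (Proj.map (gradedHom f hf) (irrelevant_le_map f hf hs) ⁻¹ᵁ
      Proj.basicOpen 𝒜 s).toScheme ≅ Spec (CommRingCat.of (Away ℬ (gradedHom f hf s))) := e
  have key : e'.inv ≫
      (Proj.map (gradedHom f hf) (irrelevant_le_map f hf hs)) ∣_ (Proj.basicOpen 𝒜 s) =
        Spec.map (CommRingCat.ofHom (Away.map (gradedHom f hf) s)) ≫
        (Proj.basicOpenIsoSpec 𝒜 s h hi).inv := by
    refine (cancel_mono (Proj.basicOpen 𝒜 s).ι).1 ?_
    rw [Category.assoc, Category.assoc, morphismRestrict_ι]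
    exact Proj.awayι_comp_map (gradedHom f hf) (irrelevant_le_map f hf hs) hi s h
  rw [← MorphismProperty.cancel_left_of_respectsIso @IsClosedImmersion e'.inv, key,
    MorphismProperty.cancel_right_of_respectsIso @IsClosedImmersion]
  exact IsClosedImmersion.spec_of_surjective
    (CommRingCat.ofHom (Away.map (gradedHom f hf) s)) (awayMap_surjective f hf hs h)

theorem isClosedImmersion_projMap (f : R →ₐ[K] B) (hf : ∀ i, ∀ x ∈ 𝒜 i, f x ∈ ℬ i)
    (hs : Function.Surjective f) : IsClosedImmersion (projMap f hf hs).left := by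
  show IsClosedImmersion (Proj.map (gradedHom f hf) (irrelevant_le_map f hf hs))
  have hcov : ⨆ s : (i : ℕ+) × 𝒜 i, Proj.basicOpen 𝒜 (s.2 : R) = ⊤ := by
    rw [← (Proj.affineOpenCover 𝒜).openCover.iSup_opensRange]
    exact iSup_congr fun s => (Proj.opensRange_awayι 𝒜 _ _ _).symm
  rw [IsZariskiLocalAtTarget.iff_of_iSup_eq_top (P := @IsClosedImmersion) _ hcov]
  exact fun s => isClosedImmersion_map_restrict f hf hs s.1.2 s.2 s.2.2

/-- The image of the closed immersion consists of the homogeneous primes containing the kernel. -/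
theorem range_projMap (f : R →ₐ[K] B) (hf : ∀ i, ∀ x ∈ 𝒜 i, f x ∈ ℬ i)
    (hs : Function.Surjective f) :
    Set.range (projMap f hf hs).left =
      {p : ProjectiveSpectrum 𝒜 | RingHom.ker f ≤ p.asHomogeneousIdeal.toIdeal} := by
  show Set.range (ProjectiveSpectrum.comap (gradedHom f hf) (irrelevant_le_map f hf hs)) = _
  ext p
  constructor
  · rintro ⟨q, rfl⟩ x hx
    show f x ∈ q.asHomogeneousIdeal.toIdeal
    rw [(RingHom.mem_ker).1 hx]
    exact Ideal.zero_mem _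
  · intro hp
    have hcomap : ∀ x, gradedHom f hf x ∈ p.asHomogeneousIdeal.map (gradedHom f hf) ↔
        x ∈ p.asHomogeneousIdeal := by
      intro x
      have h := Ideal.comap_map_of_surjective' (f : R →+* B) hs p.asHomogeneousIdeal.toIdeal
      rw [sup_eq_left.2 (show RingHom.ker (f : R →+* B) ≤ _ from hp)] at h
      exact Iff.of_eq (congrArg (x ∈ ·) h)
    refine ⟨⟨p.asHomogeneousIdeal.map (gradedHom f hf), ?_, ?_⟩, ?_⟩
    · exact Ideal.map_isPrime_of_surjective (f := (f : R →+* B)) hs hp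
    · intro hle
      refine p.not_irrelevant_le fun x hx => (hcomap x).1 (hle ?_)
      rw [HomogeneousIdeal.mem_irrelevant_iff, GradedRing.proj_apply] at hx ⊢
      rw [← (gradedHom f hf).map_directSumDecompose, hx, map_zero]
    · ext x
      exact hcomap x

theorem projMap_comp (f : R →ₐ[K] B) (hf : ∀ i, ∀ x ∈ 𝒜 i, f x ∈ ℬ i)
    (hs : Function.Surjective f) (g : B →ₐ[K] C) (hg : ∀ i, ∀ x ∈ ℬ i, g x ∈ 𝒞 i)
    (hs' : Function.Surjective g) :
    projMap g hg hs' ≫ projMap f hf hs =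
      projMap (g.comp f) (fun i x hx => hg i _ (hf i x hx)) (hs'.comp hs) := by
  ext1
  exact (Proj.map_comp (gradedHom f hf) (gradedHom g hg) (irrelevant_le_map f hf hs)
    (irrelevant_le_map g hg hs')).symm

theorem projMap_id : projMap (𝒜 := 𝒜) (AlgHom.id K R) (fun _ _ h => h) Function.surjective_id =
    𝟙 _ := by
  ext1
  exact (Proj.map_id (𝒜 := 𝒜))

theorem isReduced_projOver [IsReduced R] : AlgebraicGeometry.IsReduced (projOver K 𝒜).left := by
  have : ∀ i, AlgebraicGeometry.IsReduced ((Proj.affineOpenCover 𝒜).openCover.X i) := by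
    intro i
    have : _root_.IsReduced (Away 𝒜 (i.2 : R)) :=
      isReduced_of_injective (algebraMap (Away 𝒜 (i.2 : R)) (Localization.Away (i.2 : R)))
        (HomogeneousLocalization.val_injective _)
    exact inferInstanceAs
      (AlgebraicGeometry.IsReduced (Spec (CommRingCat.of (Away 𝒜 (i.2 : R)))))
  exact AlgebraicGeometry.IsReduced.of_openCover (X := Proj 𝒜)
    (Proj.affineOpenCover 𝒜).openCover

/-- The generic point of `Proj` of a graded domain is the zero ideal. -/
theorem isIntegral_projOver [IsDomain R] {i : ℕ} (hi : 0 < i) {x : R} (hx : x ∈ 𝒜 i)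
    (hx0 : x ≠ 0) : AlgebraicGeometry.IsIntegral (projOver K 𝒜).left := by
  have := isReduced_projOver (K := K) (𝒜 := 𝒜)
  let η : ProjectiveSpectrum 𝒜 := ⟨⊥, Ideal.isPrime_bot, fun h => hx0
    (h (HomogeneousIdeal.mem_irrelevant_of_mem 𝒜 hi hx))⟩
  have hη : closure {η} = Set.univ := by
    refine Set.eq_univ_of_forall fun p => ?_
    rw [← ProjectiveSpectrum.le_iff_mem_closure]
    exact bot_le (a := p.asHomogeneousIdeal)
  have hirr : IrreducibleSpace (ProjectiveSpectrum 𝒜) := by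
    have := isIrreducible_singleton (x := η)
    have h2 := this.closure
    rw [hη] at h2
    exact (irreducibleSpace_def _).2 h2
  have : IrreducibleSpace (projOver K 𝒜).left := hirr
  exact isIntegral_of_irreducibleSpace_of_isReduced _

variable {P R' : Type u} [CommRing P] [Algebra K P] [CommRing R'] [Algebra K R']
  {𝒢 : ℕ → Submodule K P} {ℛ : ℕ → Submodule K R'} [GradedAlgebra 𝒢] [GradedAlgebra ℛ]

/-- The homomorphism `R → B` through which a homomorphism `P → B` vanishing on the kernel of a
surjection `P → R` factors. -/
def algLift (φ : P →ₐ[K] R) (hs : Function.Surjective φ) (π : P →ₐ[K] B)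
    (h : RingHom.ker φ ≤ RingHom.ker π) : R →ₐ[K] B :=
  AlgHom.liftOfSurjective φ hs π h

theorem algLift_apply (φ : P →ₐ[K] R) (hs : Function.Surjective φ) (π : P →ₐ[K] B)
    (h : RingHom.ker φ ≤ RingHom.ker π) (x : P) : algLift φ hs π h (φ x) = π x :=
  AlgHom.liftOfSurjective_apply φ hs π h x

/-- A degree preserving homomorphism `P → B` which vanishes on the kernel of a degree preserving
surjection `P → R` factors through a degree preserving homomorphism `R → B`. -/
theorem algLift_mem {ℬ : ℕ → Submodule K B} (φ : P →ₐ[K] R) (hφ : ∀ i, ∀ x ∈ 𝒢 i, φ x ∈ 𝒜 i)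
    (hs : Function.Surjective φ) (π : P →ₐ[K] B) (hπ : ∀ i, ∀ x ∈ 𝒢 i, π x ∈ ℬ i)
    (h : RingHom.ker φ ≤ RingHom.ker π) (i : ℕ) (x : R) (hx : x ∈ 𝒜 i) :
    algLift φ hs π h x ∈ ℬ i := by
  obtain ⟨y, hy, rfl⟩ := exists_mem_of_surjective φ hφ hs hx
  rw [algLift_apply]
  exact hπ i y hy

/-- The morphism `Proj B ⟶ Proj R` for graded quotients `R → B` of `P`. -/
def projLift (φ : P →ₐ[K] R) (hφ : ∀ i, ∀ x ∈ 𝒢 i, φ x ∈ 𝒜 i) (hs : Function.Surjective φ)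
    (π : P →ₐ[K] B) (hπ : ∀ i, ∀ x ∈ 𝒢 i, π x ∈ ℬ i) (hs' : Function.Surjective π)
    (h : RingHom.ker φ ≤ RingHom.ker π) : projOver K ℬ ⟶ projOver K 𝒜 :=
  projMap (algLift φ hs π h) (algLift_mem φ hφ hs π hπ h) fun y => by
    obtain ⟨x, rfl⟩ := hs' y
    exact ⟨φ x, algLift_apply _ _ _ _ _⟩

theorem isClosedImmersion_projLift (φ : P →ₐ[K] R) (hφ : ∀ i, ∀ x ∈ 𝒢 i, φ x ∈ 𝒜 i)
    (hs : Function.Surjective φ) (π : P →ₐ[K] B) (hπ : ∀ i, ∀ x ∈ 𝒢 i, π x ∈ ℬ i)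
    (hs' : Function.Surjective π) (h : RingHom.ker φ ≤ RingHom.ker π) :
    IsClosedImmersion (projLift φ hφ hs π hπ hs' h).left :=
  isClosedImmersion_projMap _ _ fun y => by
    obtain ⟨x, rfl⟩ := hs' y
    exact ⟨φ x, algLift_apply _ _ _ _ _⟩

/-- The prime ideal of the image of a point, pulled back to `P`. -/
theorem mem_projLift (φ : P →ₐ[K] R) (hφ : ∀ i, ∀ x ∈ 𝒢 i, φ x ∈ 𝒜 i)
    (hs : Function.Surjective φ) (π : P →ₐ[K] B) (hπ : ∀ i, ∀ x ∈ 𝒢 i, π x ∈ ℬ i)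
    (hs' : Function.Surjective π) (h : RingHom.ker φ ≤ RingHom.ker π) (q : ProjectiveSpectrum ℬ)
    (x : P) : φ x ∈ (show ProjectiveSpectrum 𝒜 from
      (projLift φ hφ hs π hπ hs' h).left q).asHomogeneousIdeal ↔ π x ∈ q.asHomogeneousIdeal := by
  rw [← algLift_apply φ hs π h x]
  rfl

theorem range_projLift (φ : P →ₐ[K] R) (hφ : ∀ i, ∀ x ∈ 𝒢 i, φ x ∈ 𝒜 i)
    (hs : Function.Surjective φ) (π : P →ₐ[K] B) (hπ : ∀ i, ∀ x ∈ 𝒢 i, π x ∈ ℬ i)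
    (hs' : Function.Surjective π) (h : RingHom.ker φ ≤ RingHom.ker π) :
    Set.range (projLift φ hφ hs π hπ hs' h).left =
      {p : ProjectiveSpectrum 𝒜 |
        RingHom.ker π ≤ p.asHomogeneousIdeal.toIdeal.comap (φ : P →+* R)} := by
  refine (range_projMap _ _ _).trans ?_
  ext p
  constructor
  · intro hp x hx
    refine hp ?_
    rw [RingHom.mem_ker]
    exact (algLift_apply _ _ _ _ _).trans hx
  · intro hp y hy
    obtain ⟨x, rfl⟩ := hs y
    refine hp ((algLift_apply φ hs π h x).symm.trans hy)

theorem projLift_comp (φ : P →ₐ[K] R) (hφ : ∀ i, ∀ x ∈ 𝒢 i, φ x ∈ 𝒜 i)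
    (hs : Function.Surjective φ) (φ' : P →ₐ[K] R') (hφ' : ∀ i, ∀ x ∈ 𝒢 i, φ' x ∈ ℛ i)
    (hs' : Function.Surjective φ') (π : P →ₐ[K] B) (hπ : ∀ i, ∀ x ∈ 𝒢 i, π x ∈ ℬ i)
    (hsπ : Function.Surjective π) (h : RingHom.ker φ ≤ RingHom.ker φ')
    (h' : RingHom.ker φ' ≤ RingHom.ker π) :
    projLift φ' hφ' hs' π hπ hsπ h' ≫ projLift φ hφ hs φ' hφ' hs' h =
      projLift φ hφ hs π hπ hsπ (h.trans h') := by
  have key : (algLift φ' hs' π h').comp (algLift φ hs φ' h) =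
      algLift φ hs π (h.trans h') := by
    ext y
    obtain ⟨x, rfl⟩ := hs y
    rw [AlgHom.comp_apply, algLift_apply, algLift_apply, algLift_apply]
  refine (projMap_comp _ _ _ _ _ _).trans ?_
  congr 1

theorem projLift_self (φ : P →ₐ[K] R) (hφ : ∀ i, ∀ x ∈ 𝒢 i, φ x ∈ 𝒜 i)
    (hs : Function.Surjective φ) : projLift φ hφ hs φ hφ hs le_rfl = 𝟙 _ := by
  have key : algLift φ hs φ le_rfl = AlgHom.id K R := by
    ext y
    obtain ⟨x, rfl⟩ := hs y
    simp [algLift_apply]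
  refine Eq.trans ?_ (projMap_id (𝒜 := 𝒜))
  unfold projLift
  congr 1

/-- Graded quotients of `P` by the same ideal have isomorphic `Proj`. -/
def projIso (φ : P →ₐ[K] R) (hφ : ∀ i, ∀ x ∈ 𝒢 i, φ x ∈ 𝒜 i) (hs : Function.Surjective φ)
    (φ' : P →ₐ[K] R') (hφ' : ∀ i, ∀ x ∈ 𝒢 i, φ' x ∈ ℛ i) (hs' : Function.Surjective φ')
    (h : RingHom.ker φ = RingHom.ker φ') : projOver K 𝒜 ≅ projOver K ℛ where
  hom := projLift φ' hφ' hs' φ hφ hs h.ge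
  inv := projLift φ hφ hs φ' hφ' hs' h.le
  hom_inv_id := (projLift_comp φ hφ hs φ' hφ' hs' φ hφ hs h.le h.ge).trans (projLift_self φ hφ hs)
  inv_hom_id := (projLift_comp φ' hφ' hs' φ hφ hs φ' hφ' hs' h.ge h.le).trans
    (projLift_self φ' hφ' hs')

end ProjOver

end

/-! ### Dimension and irreducible components of topological spaces -/

section

open CategoryTheory AlgebraicGeometry TopologicalSpace

/-- The dimension of a space can be computed on an open cover: a chain of irreducible closed sets
has the same length on a member of the cover that meets its smallest element. -/
theorem topologicalKrullDim_eq_of_isOpenEmbedding_cover {X ι : Type*} [TopologicalSpace X]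
    [Nonempty ι] {U : ι → Type*} [∀ i, TopologicalSpace (U i)] (f : ∀ i, U i → X)
    (hf : ∀ i, Topology.IsOpenEmbedding (f i)) (hcov : ∀ x, ∃ i, x ∈ Set.range (f i))
    {n : WithBot ℕ∞} (hn : ∀ i, topologicalKrullDim (U i) = n) : topologicalKrullDim X = n := by
  apply le_antisymm
  · rw [topologicalKrullDim, Order.krullDim_eq_iSup_coheight]
    refine iSup_le fun Z => ?_
    obtain ⟨x, hx⟩ := Z.isIrreducible.nonempty
    obtain ⟨i, y, rfl⟩ := hcov x
    obtain ⟨Z', hZ'⟩ : ∃ Z', IrreducibleCloseds.map (f i) (hf i).continuous Z' = Z := by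
      have h1 := (IrreducibleCloseds.orderIsoOfIsOpenEmbedding (f i) (hf i)).apply_symm_apply
        ⟨Z, ⟨y, hx⟩⟩
      exact ⟨_, congrArg Subtype.val h1⟩
    rw [← hZ', (hf i).coheight_map, ← hn i]
    exact Order.coheight_le_krullDim Z'
  · obtain ⟨i⟩ := ‹Nonempty ι›
    rw [← hn i]
    exact (hf i).isInducing.topologicalKrullDim_le

/-- If a space is a finite union of irreducible closed sets, then these include all irreducible
components. -/
theorem exists_eq_of_mem_irreducibleComponents {X ι : Type*} [TopologicalSpace X] [Finite ι]
    {V : ι → Set X} (hc : ∀ i, IsClosed (V i)) (hi : ∀ i, IsIrreducible (V i))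
    (hcov : ⋃ i, V i = Set.univ) {T : Set X} (hT : T ∈ irreducibleComponents X) :
    ∃ i, T = V i := by
  classical
  obtain ⟨z, hz, hTz⟩ := isIrreducible_iff_sUnion_isClosed.1 hT.1 (Set.finite_range V).toFinset
    (by simpa using hc) (by simp [Set.sUnion_range, hcov])
  obtain ⟨i, rfl⟩ : ∃ i, V i = z := by simpa using hz
  exact ⟨i, hT.eq_of_subset (hi i) hTz⟩

end

/-! ### Krull dimension of algebras of Laurent monomials -/

section

/-- Noether normalization: the Krull dimension of an affine domain is the number of elements of a
transcendence basis. -/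
theorem ringKrullDim_eq_card_of_isTranscendenceBasis {K B : Type u} [Field K] [CommRing B]
    [IsDomain B] [Algebra K B] [Algebra.FiniteType K B] {ι : Type} [Finite ι] {x : ι → B}
    (hx : IsTranscendenceBasis K x) : ringKrullDim B = Nat.card ι := by
  obtain ⟨s, g, hg, hint⟩ := exists_integral_inj_algHom_of_fg K B
  algebraize [g.toRingHom]
  have : Algebra.IsIntegral (MvPolynomial (Fin s) K) B := ⟨hint⟩
  have hinj : Function.Injective (algebraMap (MvPolynomial (Fin s) K) B) := hg
  have : FaithfulSMul (MvPolynomial (Fin s) K) B :=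
    (faithfulSMul_iff_algebraMap_injective _ _).2 hinj
  have htr : IsScalarTower K (MvPolynomial (Fin s) K) B :=
    IsScalarTower.of_algebraMap_eq fun r => (g.commutes r).symm
  have hdim : ringKrullDim B = ringKrullDim (MvPolynomial (Fin s) K) := by
    apply le_antisymm
    · refine Order.krullDim_le_of_strictMono
        (PrimeSpectrum.comap (algebraMap (MvPolynomial (Fin s) K) B)) fun I J h => ?_
      exact Ideal.IsIntegral.comap_lt_comap (R := MvPolynomial (Fin s) K) h
    · refine iSup_le fun l => ?_
      obtain ⟨P, hP⟩ := Ideal.nonempty_primesOver (S := B) (RelSeries.head l).asIdeal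
      have := hP.1
      have := hP.2
      obtain ⟨L, hL, -⟩ := Ideal.exists_ltSeries_of_hasGoingUp l P
      rw [← hL]
      exact Order.LTSeries.length_le_krullDim L
  have hX : IsTranscendenceBasis K (algebraMap (MvPolynomial (Fin s) K) B ∘ MvPolynomial.X) :=
    (IsTranscendenceBasis.mvPolynomial (Fin s) K).algebraMap_comp
  have hc := hx.lift_cardinalMk_eq hX
  have hc' : Nat.card ι = s := by
    simpa [Nat.card] using congrArg Cardinal.toNat hc
  rw [hdim, hc']
  simp

variable {d : ℕ}

theorem aeval_single_monomial (K : Type u) [Field K] {ι G : Type*} [AddCommMonoid G]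
    (v : ι → G) (α : ι →₀ ℕ) (c : K) :
    MvPolynomial.aeval (fun i => AddMonoidAlgebra.single (v i) (1 : K))
      (MvPolynomial.monomial α c) = AddMonoidAlgebra.single (α.sum fun i n => n • v i) c := by
  have key : (α.prod fun i k => AddMonoidAlgebra.single (v i) (1 : K) ^ k) =
      AddMonoidAlgebra.single (α.sum fun i n => n • v i) 1 := by
    induction α using Finsupp.induction_linear with
    | zero => simp [AddMonoidAlgebra.one_def]
    | add α β hα hβ =>
      rw [Finsupp.prod_add_index' (by simp) (fun i m n => pow_add _ m n), hα, hβ,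
        Finsupp.sum_add_index' (by simp) (fun i m n => add_smul m n _),
        AddMonoidAlgebra.single_mul_single, one_mul]
    | single i n => simp [AddMonoidAlgebra.single_pow]
  rw [MvPolynomial.aeval_monomial, key, AddMonoidAlgebra.coe_algebraMap]
  simp [AddMonoidAlgebra.single_mul_single]

/-- The ring of Laurent polynomials is algebraic over the polynomial ring in the variables, because
each Laurent monomial is a quotient of two monomials. -/
theorem isAlgebraic_adjoin_laurent (K : Type u) [Field K] :
    Algebra.IsAlgebraic (Algebra.adjoin K (Set.range fun i : Fin d =>
      (AddMonoidAlgebra.single (Pi.single i 1 : Fin d → ℤ) (1 : K))))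
      (AddMonoidAlgebra K (Fin d → ℤ)) := by
  set S := Algebra.adjoin K (Set.range fun i : Fin d =>
      (AddMonoidAlgebra.single (Pi.single i 1 : Fin d → ℤ) (1 : K))) with hS
  have hmem : ∀ (α : Fin d →₀ ℕ) (c : K),
      AddMonoidAlgebra.single (fun i => (α i : ℤ)) c ∈ S := by
    intro α c
    rw [hS, Algebra.adjoin_range_eq_range_aeval]
    refine ⟨MvPolynomial.monomial α c, ?_⟩
    refine (aeval_single_monomial K _ α c).trans ?_
    congr 1
    ext i
    simp [Finsupp.sum_fintype, Pi.single_apply]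
  refine ⟨fun f => ?_⟩
  have hsingle : ∀ (u : Fin d → ℤ) (c : K), IsAlgebraic S (AddMonoidAlgebra.single u c) := by
    intro u c
    let α : Fin d →₀ ℕ := Finsupp.equivFunOnFinite.symm fun i => (u i).toNat
    let β : Fin d →₀ ℕ := Finsupp.equivFunOnFinite.symm fun i => (-u i).toNat
    let a : S := ⟨_, hmem β 1⟩
    let b : S := ⟨_, hmem α c⟩
    have ha : a ≠ 0 := by
      intro h
      have h2 := congrArg Subtype.val h
      have h3 : AddMonoidAlgebra.single (fun i => (β i : ℤ)) (1 : K) = 0 := h2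
      simp at h3
    refine ⟨Polynomial.C a * Polynomial.X - Polynomial.C b, ?_, ?_⟩
    · intro h
      have := congrArg (fun p => Polynomial.coeff p 1) h
      simp [Polynomial.coeff_C] at this
      exact ha this
    · have : AddMonoidAlgebra.single (fun i => (β i : ℤ)) (1 : K) * AddMonoidAlgebra.single u c =
          AddMonoidAlgebra.single (fun i => (α i : ℤ)) c := by
        rw [AddMonoidAlgebra.single_mul_single, one_mul]
        congr 1
        ext i
        simp [α, β]
        omega
      simp only [map_sub, map_mul, Polynomial.aeval_C, Polynomial.aeval_X]
      exact sub_eq_zero.2 this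
  induction f using AddMonoidAlgebra.induction_linear with
  | zero => exact isAlgebraic_zero
  | add f g hf hg => exact hf.add hg
  | single u c => exact hsingle u c

/-- Monomials with linearly independent exponents are algebraically independent. -/
theorem algebraicIndependent_single (K : Type u) [Field K] {ι G : Type*} [AddCommGroup G]
    {v : ι → G} (hv : LinearIndependent ℤ v) :
    AlgebraicIndependent K fun i => (AddMonoidAlgebra.single (v i) (1 : K)) := by
  let h : (ι →₀ ℕ) →+ G := Finsupp.liftAddHom fun i => (multiplesHom G (v i))
  have hh : Function.Injective h := by
    intro α β hαβ
    have key : ∀ α : ι →₀ ℕ, h α = Finsupp.linearCombination ℤ v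
        (α.mapRange (Nat.cast : ℕ → ℤ) Nat.cast_zero) := by
      intro α
      rw [Finsupp.linearCombination_apply, Finsupp.sum_mapRange_index (by simp)]
      simp [h, Finsupp.sum]
    rw [key, key] at hαβ
    exact Finsupp.mapRange_injective _ Nat.cast_zero Nat.cast_injective (hv hαβ)
  have : (MvPolynomial.aeval fun i => (AddMonoidAlgebra.single (v i) (1 : K))) =
      (AddMonoidAlgebra.mapDomainAlgHom K K h : MvPolynomial ι K →ₐ[K] AddMonoidAlgebra K G) := by
    refine MvPolynomial.algHom_ext fun i => ?_
    rw [MvPolynomial.aeval_X]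
    refine Eq.trans ?_ (AddMonoidAlgebra.mapDomain_single (f := h)).symm
    congr 1
    simp [h]
  rw [AlgebraicIndependent, this]
  exact AddMonoidAlgebra.mapDomain_injective hh

theorem exists_linearIndependent_int {V : Set (Fin d → ℤ)}
    (hspan : Submodule.span ℝ (latticePt '' V) = ⊤) :
    ∃ (ι : Type) (_ : Finite ι) (v : ι → Fin d → ℤ), (∀ i, v i ∈ V) ∧ LinearIndependent ℤ v ∧
      Nat.card ι = d := by
  obtain ⟨b, hb, hbs, hli⟩ := exists_linearIndependent ℝ (latticePt '' V)
  choose v hv hvb using fun x : b => hb x.2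
  have hfin : Finite b := hli.finite
  refine ⟨b, hfin, v, hv, ?_, ?_⟩
  · let L : (Fin d → ℤ) →ₗ[ℤ] (Fin d → ℝ) :=
      { toFun := latticePt
        map_add' := fun x y => by ext; simp [latticePt]
        map_smul' := fun x y => by ext; simp [latticePt] }
    have h1 : LinearIndependent ℤ (fun x : b => (x : Fin d → ℝ)) :=
      LinearIndependent.restrict_scalars' ℤ hli
    refine LinearIndependent.of_comp L ?_
    convert h1 using 1
    ext x : 1
    exact hvb x
  · have hB := Module.Basis.mk hli (by simp [hbs, hspan])
    rw [← Module.finrank_eq_nat_card_basis hB]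
    simp

/-- The algebra generated by finitely many Laurent monomials whose exponents span `ℝ^d` has
dimension `d`. -/
theorem ringKrullDim_adjoin_single (K : Type u) [Field K] {V : Set (Fin d → ℤ)} (hV : V.Finite)
    (hspan : Submodule.span ℝ (latticePt '' V) = ⊤) :
    ringKrullDim (Algebra.adjoin K ((fun v => AddMonoidAlgebra.single v (1 : K)) '' V)) = d := by
  obtain ⟨ι, _, v, hvV, hli, hcard⟩ := exists_linearIndependent_int hspan
  set B := Algebra.adjoin K ((fun v => AddMonoidAlgebra.single v (1 : K)) '' V) with hB
  have hft : Algebra.FiniteType K B :=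
    (Subalgebra.fg_iff_finiteType B).1
      ⟨(hV.image fun v => AddMonoidAlgebra.single v (1 : K)).toFinset, by simp [hB]⟩
  let x : ι → B := fun i => ⟨AddMonoidAlgebra.single (v i) 1,
    Algebra.subset_adjoin ⟨v i, hvV i, rfl⟩⟩
  have hx : AlgebraicIndependent K x :=
    AlgebraicIndependent.of_comp B.val (algebraicIndependent_single K hli)
  have halg := isAlgebraic_adjoin_laurent (d := d) K
  have htr : Algebra.trdeg K B ≤ d :=
    (_root_.trdeg_le_of_injective B.val Subtype.val_injective).trans
      ((Algebra.IsAlgebraic.trdeg_le_cardinalMk K _).trans (by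
        have h := Cardinal.mk_range_le_lift (f := fun i : Fin d =>
          (AddMonoidAlgebra.single (Pi.single i 1 : Fin d → ℤ) (1 : K)))
        simpa using h))
  have hbasis : IsTranscendenceBasis K x := by
    refine hx.isTranscendenceBasis_of_lift_trdeg_le_of_finite ?_
    have hc : Cardinal.mk ι = d := by rw [← Nat.cast_card, hcard]
    simpa [hc] using htr
  rw [ringKrullDim_eq_card_of_isTranscendenceBasis hbasis, hcard]

end

/-! ### The dimension of the toric variety of a cell -/

section

open CategoryTheory AlgebraicGeometry HomogeneousLocalization

section CellDim
variable {d : ℕ} {s : Finset (Fin d → ℤ)}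

/-- The generator `(1, χ)` of the monoid of `s`. -/
def cellGen (χ : s) : cellMonoid s := ⟨(1, χ), AddSubmonoid.subset_closure ⟨χ, χ.2, rfl⟩⟩

theorem cellMonoid_induction {p : cellMonoid s → Prop} (h0 : p 0)
    (hadd : ∀ χ m, p m → p (cellGen χ + m)) (m : cellMonoid s) : p m := by
  obtain ⟨m, hm⟩ := m
  induction hm using AddSubmonoid.closure_induction_left with
  | zero => exact h0
  | add_left x hx y hy ih =>
    obtain ⟨χ, hχ, rfl⟩ := hx
    exact hadd ⟨χ, hχ⟩ _ ih

theorem cellMonoid_cases (m : cellMonoid s) : m = 0 ∨ ∃ χ m', m = cellGen χ + m' :=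
  cellMonoid_induction (p := fun m => m = 0 ∨ ∃ χ m', m = cellGen χ + m') (Or.inl rfl)
    (fun χ m _ => Or.inr ⟨χ, m, rfl⟩) m

/-- The dehomogenization `(k, u) ↦ u - k χ` of the exponents. -/
def dehom (χ : s) : cellMonoid s →+ (Fin d → ℤ) where
  toFun m := m.1.2 - m.1.1 • χ.1
  map_zero' := by simp
  map_add' m n := by simp [add_smul]; abel

theorem dehom_cellGen (χ χ' : s) : dehom χ (cellGen χ') = χ'.1 - χ.1 := by
  simp [dehom, cellGen]

theorem eq_of_dehom_eq (χ : s) {m n : cellMonoid s} (h : cellDeg s m = cellDeg s n)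
    (h' : dehom χ m = dehom χ n) : m = n := by
  have h1 : m.1.1 = n.1.1 := h
  have h2 : m.1.2 - m.1.1 • χ.1 = n.1.2 - n.1.1 • χ.1 := h'
  refine Subtype.ext (Prod.ext h1 ?_)
  rw [h1] at h2
  exact sub_left_inj.1 h2

variable (K : Type u) [Field K]

theorem single_cellGen_mem (χ : s) :
    AddMonoidAlgebra.single (cellGen χ) (1 : K) ∈ AddMonoidAlgebra.gradeBy K (cellDeg s) 1 :=
  AddMonoidAlgebra.single_mem_gradeBy (cellDeg s) (cellGen χ) 1

/-- Dehomogenization with respect to the variable of `χ`. -/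
def dehomHom (χ : s) : AddMonoidAlgebra K (cellMonoid s) →ₐ[K] AddMonoidAlgebra K (Fin d → ℤ) :=
  AddMonoidAlgebra.mapDomainAlgHom K K (dehom χ)

theorem dehomHom_single (χ : s) (m : cellMonoid s) (c : K) :
    dehomHom K χ (AddMonoidAlgebra.single m c) = AddMonoidAlgebra.single (dehom χ m) c :=
  AddMonoidAlgebra.mapDomain_single

theorem dehomHom_cellGen (χ : s) :
    dehomHom K χ (AddMonoidAlgebra.single (cellGen χ) 1) = 1 := by
  rw [dehomHom_single, dehom_cellGen, sub_self, AddMonoidAlgebra.one_def]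

/-- Dehomogenization loses no information in a fixed degree. -/
theorem dehomHom_injOn (χ : s) {n : ℕ} {a : AddMonoidAlgebra K (cellMonoid s)}
    (ha : a ∈ AddMonoidAlgebra.gradeBy K (cellDeg s) n) (h : dehomHom K χ a = 0) : a = 0 := by
  have h' : Finsupp.mapDomain (dehom χ) a.coeff = Finsupp.mapDomain (dehom χ) 0 := by
    have := congrArg AddMonoidAlgebra.coeff h
    simpa [dehomHom] using this
  have h2 := Finsupp.mapDomain_injOn (M := K) {m : cellMonoid s | cellDeg s m = n}
    (f := dehom χ) (fun x hx y hy hxy => eq_of_dehom_eq χ (hx.trans hy.symm) hxy)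
    (show (a.coeff.support : Set (cellMonoid s)) ⊆ _ from ha) (by simp) h'
  exact AddMonoidAlgebra.coeff_injective h2

/-- The coordinate ring of a standard chart as a ring of Laurent polynomials. -/
def chartHom (χ : s) : Away (AddMonoidAlgebra.gradeBy K (cellDeg s))
    (AddMonoidAlgebra.single (cellGen χ) (1 : K)) →+* AddMonoidAlgebra K (Fin d → ℤ) :=
  (IsLocalization.Away.lift (S := Localization.Away (AddMonoidAlgebra.single (cellGen χ) (1 : K)))
    (AddMonoidAlgebra.single (cellGen χ) (1 : K)) (g := (dehomHom K χ).toRingHom)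
    (by show IsUnit (dehomHom K χ _); rw [dehomHom_cellGen]; exact isUnit_one)).comp
    (algebraMap _ _)

theorem chartHom_mk (χ : s) (n : ℕ) (a : AddMonoidAlgebra K (cellMonoid s))
    (ha : a ∈ AddMonoidAlgebra.gradeBy K (cellDeg s) (n • 1)) :
    chartHom K χ (Away.mk _ (single_cellGen_mem K χ) n a ha) = dehomHom K χ a := by
  show IsLocalization.lift _ (Away.mk _ (single_cellGen_mem K χ) n a ha).val = _
  rw [Away.val_mk, Localization.mk_eq_mk', IsLocalization.lift_mk'_spec]
  show dehomHom K χ a = dehomHom K χ (_ ^ n) * _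
  rw [map_pow, dehomHom_cellGen, one_pow, one_mul]

theorem chartHom_injective (χ : s) : Function.Injective (chartHom K χ) := by
  rw [injective_iff_map_eq_zero]
  intro x hx
  obtain ⟨n, a, ha, rfl⟩ := x.mk_surjective _ (single_cellGen_mem K χ)
  rw [chartHom_mk] at hx
  have := dehomHom_injOn K χ ha hx
  subst this
  apply HomogeneousLocalization.val_injective
  rw [Away.val_mk, Localization.mk_zero, HomogeneousLocalization.val_zero]

theorem range_chartHom (χ : s) : (chartHom K χ).range =
    (Algebra.adjoin K ((fun v => AddMonoidAlgebra.single v (1 : K)) ''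
      ((fun χ' => χ' - χ.1) '' (s : Set (Fin d → ℤ))))).toSubring := by
  apply le_antisymm
  · rintro _ ⟨x, rfl⟩
    obtain ⟨n, a, ha, rfl⟩ := x.mk_surjective _ (single_cellGen_mem K χ)
    rw [chartHom_mk]
    clear ha
    induction a using AddMonoidAlgebra.induction_linear with
    | zero => rw [map_zero]; exact Subring.zero_mem _
    | add f g hf hg => rw [map_add]; exact Subring.add_mem _ hf hg
    | single m c =>
      rw [dehomHom_single]
      induction m using cellMonoid_induction with
      | h0 =>
        rw [map_zero]
        exact Subalgebra.algebraMap_mem _ c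
      | hadd χ' m ih =>
        rw [map_add, ← one_mul c, ← AddMonoidAlgebra.single_mul_single]
        refine Subring.mul_mem _ (Algebra.subset_adjoin ?_) ih
        exact ⟨_, ⟨χ', χ'.2, rfl⟩, by rw [dehom_cellGen]⟩
  · intro x hx
    refine Algebra.adjoin_induction (p := fun x _ => x ∈ (chartHom K χ).range) ?_ ?_ ?_ ?_ hx
    · rintro _ ⟨_, ⟨χ', hχ', rfl⟩, rfl⟩
      refine ⟨Away.mk _ (single_cellGen_mem K χ) 1
        (AddMonoidAlgebra.single (cellGen ⟨χ', hχ'⟩) 1) (single_cellGen_mem K _), ?_⟩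
      rw [chartHom_mk, dehomHom_single, dehom_cellGen]
    · intro c
      refine ⟨Away.mk _ (single_cellGen_mem K χ) 0 (AddMonoidAlgebra.single 0 c)
        (by simpa using AddMonoidAlgebra.single_mem_gradeBy (cellDeg s) 0 c), ?_⟩
      rw [chartHom_mk, dehomHom_single, map_zero]
      rfl
    · exact fun x y _ _ => Subring.add_mem _
    · exact fun x y _ _ => Subring.mul_mem _

theorem span_sub_eq_top (hs : affineSpan ℝ (latticePt '' (s : Set (Fin d → ℤ))) = ⊤) (χ : s) :
    Submodule.span ℝ (latticePt '' ((fun χ' => χ' - χ.1) '' (s : Set (Fin d → ℤ)))) = ⊤ := by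
  have h := AffineSubspace.vectorSpan_eq_top_of_affineSpan_eq_top ℝ _ _ hs
  rw [vectorSpan_eq_span_vsub_set_right ℝ
    (Set.mem_image_of_mem latticePt (Finset.mem_coe.2 χ.2))] at h
  rw [← h, Set.image_image, Set.image_image]
  congr 1
  refine Set.image_congr fun χ' _ => ?_
  ext i
  simp [latticePt]

theorem ringKrullDim_chart (hs : affineSpan ℝ (latticePt '' (s : Set (Fin d → ℤ))) = ⊤) (χ : s) :
    ringKrullDim (Away (AddMonoidAlgebra.gradeBy K (cellDeg s))
      (AddMonoidAlgebra.single (cellGen χ) (1 : K))) = d := by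
  rw [← ringKrullDim_adjoin_single K (s.finite_toSet.image _) (span_sub_eq_top hs χ)]
  refine ringKrullDim_eq_of_ringEquiv
    ((RingEquiv.ofBijective (chartHom K χ).rangeRestrict ⟨?_, ?_⟩).trans
      (RingEquiv.subringCongr (range_chartHom K χ)))
  · exact fun x y h => chartHom_injective K χ (congrArg Subtype.val h)
  · exact (chartHom K χ).rangeRestrict_surjective

theorem irrelevant_le_span_cellGen :
    (HomogeneousIdeal.irrelevant (AddMonoidAlgebra.gradeBy K (cellDeg s))).toIdeal ≤
      Ideal.span (Set.range fun χ : s => AddMonoidAlgebra.single (cellGen χ) (1 : K)) := by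
  rw [HomogeneousIdeal.toIdeal_irrelevant_le]
  intro i hi x hx
  rw [← x.sum_coeff_single]
  refine Ideal.sum_mem _ fun m hm => ?_
  have hdeg : cellDeg s m = i :=
    (AddMonoidAlgebra.mem_gradeBy_iff K (cellDeg s) i x).1 hx (Finset.mem_coe.2 hm)
  rcases cellMonoid_cases m with rfl | ⟨χ, m, rfl⟩
  · exact absurd (hdeg.symm.trans (map_zero (cellDeg s))) hi.ne'
  · show AddMonoidAlgebra.single (cellGen χ + m) (x.coeff (cellGen χ + m)) ∈ Ideal.span _
    rw [← one_mul (x.coeff _), ← AddMonoidAlgebra.single_mul_single]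
    exact Ideal.mul_mem_right _ _ (Ideal.subset_span ⟨χ, rfl⟩)

/-- The toric variety of a full dimensional set of lattice points in `ℝ^d` has dimension `d`. -/
theorem topologicalKrullDim_cellVariety
    (hs : affineSpan ℝ (latticePt '' (s : Set (Fin d → ℤ))) = ⊤) (hne : s.Nonempty) :
    topologicalKrullDim (cellVariety K s).left = d := by
  have : Nonempty s := hne.to_subtype
  let 𝒰 := Proj.affineOpenCoverOfIrrelevantLESpan (AddMonoidAlgebra.gradeBy K (cellDeg s))
    (fun χ : s => AddMonoidAlgebra.single (cellGen χ) (1 : K)) (m := fun _ => 1)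
    (single_cellGen_mem K) (fun _ => one_pos) (irrelevant_le_span_cellGen K)
  refine topologicalKrullDim_eq_of_isOpenEmbedding_cover (X := (cellVariety K s).left) (ι := s)
    (U := fun χ => Spec (𝒰.X χ)) (fun χ => 𝒰.f χ)
    (fun χ => (Proj.awayι _ _ (single_cellGen_mem K χ) one_pos).isOpenEmbedding)
    (fun x => ⟨_, 𝒰.covers x⟩) fun χ => ?_
  rw [← ringKrullDim_chart K hs χ]
  exact PrimeSpectrum.topologicalKrullDim_eq_ringKrullDim _

end CellDim

end

/-! ### The homogeneous ideal of the toric variety of a cell -/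

section CellHom
variable {d : ℕ} (K : Type u) [Field K] (A s : Finset (Fin d → ℤ))

open Classical in
/-- The homomorphism `K[x_χ ∣ χ ∈ A] → K[S]` which sends `x_χ` to the monomial of `(1, χ)` if
`χ ∈ s` and to `0` otherwise. -/
def cellHom : MvPolynomial A K →ₐ[K] AddMonoidAlgebra K (cellMonoid s) :=
  MvPolynomial.aeval fun χ : A =>
    if h : χ.1 ∈ s then AddMonoidAlgebra.single (cellGen ⟨χ.1, h⟩) 1 else 0

/-- The multidegree `∑ α_χ (1, χ)` of an exponent `α`. -/
def mdeg : (A →₀ ℕ) →+ ℕ × (Fin d → ℤ) :=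
  Finsupp.liftAddHom fun χ : A => multiplesHom _ ((1, χ.1) : ℕ × (Fin d → ℤ))

variable {A} in
/-- The variables occurring in `x^α` belong to `s`. -/
def SuppIn (α : A →₀ ℕ) : Prop := ∀ χ ∈ α.support, χ.1 ∈ s

theorem mdeg_apply (α : A →₀ ℕ) : mdeg A α = ∑ χ, α χ • ((1, χ.1) : ℕ × (Fin d → ℤ)) := by
  rw [mdeg, Finsupp.liftAddHom_apply, Finsupp.sum_fintype _ _ (by simp)]
  rfl

theorem mdeg_fst (α : A →₀ ℕ) : (mdeg A α).1 = α.degree := by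
  simp [mdeg_apply, Prod.fst_sum, Finsupp.degree_eq_sum]

variable {s} in
/-- The inclusion of `K[S]` into `K[ℕ × ℤ^d]`. -/
def cellIncl : AddMonoidAlgebra K (cellMonoid s) →ₐ[K] AddMonoidAlgebra K (ℕ × (Fin d → ℤ)) :=
  AddMonoidAlgebra.mapDomainAlgHom K K (cellMonoid s).subtype

theorem cellIncl_injective : Function.Injective (cellIncl K (s := s)) :=
  AddMonoidAlgebra.mapDomain_injective Subtype.val_injective

instance : IsDomain (AddMonoidAlgebra K (cellMonoid s)) :=
  (cellIncl_injective K s).isDomain (cellIncl K (s := s)).toRingHom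

theorem cellIncl_cellHom_X (χ : A) : cellIncl K (cellHom K A s (MvPolynomial.X χ)) =
    open Classical in if χ.1 ∈ s then AddMonoidAlgebra.single (1, χ.1) 1 else 0 := by
  rw [cellHom, MvPolynomial.aeval_X]
  split_ifs
  · exact AddMonoidAlgebra.mapDomain_single
  · exact map_zero _

theorem cellIncl_cellHom_monomial (α : A →₀ ℕ) (c : K) :
    cellIncl K (cellHom K A s (MvPolynomial.monomial α c)) =
    open Classical in if SuppIn s α then AddMonoidAlgebra.single (mdeg A α) c else 0 := by
  classical
  have h1 : cellIncl K (cellHom K A s (MvPolynomial.monomial α c)) =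
      algebraMap K _ c * α.prod fun χ k =>
        cellIncl K (cellHom K A s (MvPolynomial.X χ)) ^ k := by
    rw [MvPolynomial.monomial_eq, map_mul, map_mul, ← MvPolynomial.algebraMap_eq,
      AlgHom.commutes, AlgHom.commutes, map_finsuppProd, map_finsuppProd]
    simp only [map_pow]
  rw [h1]
  split_ifs with h
  · have h2 := aeval_single_monomial K (fun χ : A => ((1, χ.1) : ℕ × (Fin d → ℤ))) α c
    rw [MvPolynomial.aeval_monomial] at h2
    refine Eq.trans ?_ h2
    congr 1
    refine Finsupp.prod_congr fun χ hχ => ?_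
    rw [cellIncl_cellHom_X, if_pos (h χ hχ)]
  · unfold SuppIn at h
    push Not at h
    obtain ⟨χ, hχ, hχs⟩ := h
    rw [Finsupp.prod, Finset.prod_eq_zero hχ, mul_zero]
    rw [cellIncl_cellHom_X, if_neg hχs, zero_pow (Finsupp.mem_support_iff.1 hχ)]

theorem coeff_cellIncl_cellHom (p : MvPolynomial A K) (m : ℕ × (Fin d → ℤ)) :
    (cellIncl K (cellHom K A s p)).coeff m = open Classical in
      ∑ α ∈ p.support, (if SuppIn s α ∧ mdeg A α = m then p.coeff α else 0) := by
  conv_lhs => rw [p.as_sum, map_sum, map_sum]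
  rw [AddMonoidAlgebra.coeff_sum, Finsupp.finsetSum_apply]
  refine Finset.sum_congr rfl fun α _ => ?_
  rw [cellIncl_cellHom_monomial]
  by_cases h1 : SuppIn s α <;> simp [h1, Finsupp.single_apply]

/-- The kernel of `cellHom` in terms of coefficients: those of the exponents in `s` of any given
multidegree add up to `0`. -/
theorem mem_ker_cellHom {p : MvPolynomial A K} : p ∈ RingHom.ker (cellHom K A s) ↔
    ∀ m, open Classical in
      ∑ α ∈ p.support, (if SuppIn s α ∧ mdeg A α = m then p.coeff α else 0) = 0 := by
  rw [RingHom.mem_ker, ← map_eq_zero_iff _ (cellIncl_injective K s)]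
  rw [← AddMonoidAlgebra.coeff_eq_zero, Finsupp.ext_iff]
  exact forall_congr' fun m => by rw [coeff_cellIncl_cellHom]; rfl

theorem cellHom_surjective (hs : s ⊆ A) : Function.Surjective (cellHom K A s) := by
  intro f
  show f ∈ (cellHom K A s).range
  induction f using AddMonoidAlgebra.induction_linear with
  | zero => exact Subalgebra.zero_mem _
  | add f g hf hg => exact Subalgebra.add_mem _ hf hg
  | single m c =>
    induction m using cellMonoid_induction with
    | h0 => exact Subalgebra.algebraMap_mem _ c
    | hadd χ m ih =>
      rw [← one_mul c, ← AddMonoidAlgebra.single_mul_single]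
      refine Subalgebra.mul_mem _ ⟨MvPolynomial.X ⟨χ.1, hs χ.2⟩, ?_⟩ ih
      show cellHom K A s _ = _
      rw [cellHom, MvPolynomial.aeval_X, dif_pos χ.2]

theorem cellHom_mem (i : ℕ) (p : MvPolynomial A K)
    (hp : p ∈ MvPolynomial.homogeneousSubmodule A K i) :
    cellHom K A s p ∈ AddMonoidAlgebra.gradeBy K (cellDeg s) i := by
  classical
  rw [p.as_sum, map_sum]
  refine Submodule.sum_mem _ fun α hα => ?_
  have hdeg : α.degree = i := by
    rw [Finsupp.degree_eq_weight_one]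
    exact (MvPolynomial.mem_homogeneousSubmodule i p).1 hp (MvPolynomial.mem_support_iff.1 hα)
  rw [AddMonoidAlgebra.mem_gradeBy_iff]
  intro m hm
  have h1 : (m : ℕ × (Fin d → ℤ)) ∈
      (cellIncl K (cellHom K A s (MvPolynomial.monomial α (p.coeff α)))).coeff.support := by
    rw [Finsupp.mem_support_iff]
    show Finsupp.mapDomain (cellMonoid s).subtype _ ((cellMonoid s).subtype m) ≠ 0
    rw [Finsupp.mapDomain_apply (f := (cellMonoid s).subtype) Subtype.val_injective]
    exact Finsupp.mem_support_iff.1 hm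
  rw [cellIncl_cellHom_monomial] at h1
  split_ifs at h1
  · have h2 := Finset.mem_singleton.1 (Finsupp.support_single_subset h1)
    show (m : ℕ × (Fin d → ℤ)).1 = i
    rw [h2, mdeg_fst, hdeg]
  · simp at h1

/-- The character of the torus `Kˣ × (Kˣ)^d` with exponent `m`. -/
def torusChar (m : ℕ × (Fin d → ℤ)) : Kˣ × (Fin d → Kˣ) →* K :=
  (Units.coeHom K).comp
    { toFun := fun z => z.1 ^ m.1 * ∏ i, z.2 i ^ m.2 i
      map_one' := by simp
      map_mul' := fun z w => by
        simp only [Prod.fst_mul, Prod.snd_mul, Pi.mul_apply, mul_pow, mul_zpow,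
          Finset.prod_mul_distrib]
        exact mul_mul_mul_comm _ _ _ _ }

/-- Different exponents give different characters. -/
theorem torusChar_injective [CharZero K] : Function.Injective (torusChar K (d := d)) := by
  -- evaluate at elements of the torus whose only coordinate different from `1` is `2`, which has
  -- infinite order in characteristic zero
  have h2 : (2 : K) ≠ 0 := two_ne_zero
  have hz : ∀ a b : ℤ, (2 : K) ^ a = 2 ^ b → a = b := by
    intro a b h
    have h' : (2 : ℚ) ^ a = 2 ^ b := by
      apply Rat.cast_injective (α := K)
      push_cast
      exact h
    exact zpow_right_injective₀ (by norm_num) (by norm_num) h'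
  intro m n h
  refine Prod.ext ?_ (funext fun i => ?_)
  · have := DFunLike.congr_fun h (Units.mk0 2 h2, 1)
    simp [torusChar] at this
    exact_mod_cast hz m.1 n.1 (by exact_mod_cast this)
  · have := DFunLike.congr_fun h (1, Pi.mulSingle i (Units.mk0 2 h2))
    have h3 : ∀ v : Fin d → ℤ, ∏ j, (Pi.mulSingle i (Units.mk0 2 h2) : Fin d → Kˣ) j ^ v j =
        (Units.mk0 2 h2) ^ v i := by
      intro v
      rw [Finset.prod_eq_single i (fun j _ hj => by rw [Pi.mulSingle_eq_of_ne hj, one_zpow])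
        (by simp), Pi.mulSingle_eq_same]
    simp only [torusChar, MonoidHom.coe_comp, Function.comp_apply, MonoidHom.coe_mk,
      OneHom.coe_mk, one_pow, one_mul, h3, Units.coeHom_apply, Units.val_zpow_eq_zpow_val,
      Units.val_mk0] at this
    exact hz _ _ this

/-- By the independence of characters, the ideal of the affine toric variety is the kernel of the
map to the monoid algebra. -/
theorem toricIdeal_eq_ker [CharZero K] : toricIdeal K A = RingHom.ker (cellHom K A A) := by
  have hev : ∀ z (p : MvPolynomial A K), MvPolynomial.aeval (torusMap K A z) p =
      (cellIncl K (cellHom K A A p)).coeff.sum fun m c => c * torusChar K m z := by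
    intro z p
    let F : Multiplicative (ℕ × (Fin d → ℤ)) →* K :=
      { toFun := fun m => torusChar K m.toAdd z
        map_one' := by simp [torusChar]
        map_mul' := fun m n => by
          simp [torusChar, pow_add, zpow_add, Finset.prod_mul_distrib]
          ring }
    have h : MvPolynomial.aeval (torusMap K A z) =
        (AddMonoidAlgebra.lift K K _ F).comp ((cellIncl K).comp (cellHom K A A)) := by
      refine MvPolynomial.algHom_ext fun χ => ?_
      rw [MvPolynomial.aeval_X, AlgHom.comp_apply, AlgHom.comp_apply, cellIncl_cellHom_X,
        if_pos χ.2, AddMonoidAlgebra.lift_single]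
      simp [F, torusMap, torusChar]
    rw [h]
    exact AddMonoidAlgebra.lift_apply _ _
  ext p
  rw [mem_toricIdeal, RingHom.mem_ker]
  constructor
  · intro h
    rw [← map_eq_zero_iff _ (cellIncl_injective K A), ← AddMonoidAlgebra.coeff_eq_zero]
    have hli := (linearIndependent_monoidHom (Kˣ × (Fin d → Kˣ)) K).comp _
      (torusChar_injective K)
    refine linearIndependent_iff.1 hli _ ?_
    ext z
    rw [Finsupp.linearCombination_apply, Finsupp.sum_apply']
    exact (hev z p).symm.trans (h z)
  · intro h z
    rw [hev, h, map_zero]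
    simp

end CellHom

/-! ### The associated graded algebra as a quotient of the polynomial ring -/

namespace QuasiValuation
variable {K R Γ : Type*} [Field K] [CommRing R] [Algebra K R] [AddCommGroup Γ] [LinearOrder Γ]
  [IsOrderedAddMonoid Γ] (ν : QuasiValuation K R Γ)

/-- The class of `x ∈ F_{≥ a}` in degree `a` of the associated graded algebra. -/
def symb (a : Γ) : ν.ge a →ₗ[K] ν.Gr := (ν.ofLeaf a).comp (ν.cls a)

theorem symb_congr {a b : Γ} {x y : R} (hx : x ∈ ν.ge a) (hy : y ∈ ν.ge b) (hab : a = b)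
    (hxy : x = y) : ν.symb a ⟨x, hx⟩ = ν.symb b ⟨y, hy⟩ := by
  subst hab; subst hxy; rfl

theorem symb_mul {a b : Γ} (x : ν.ge a) (y : ν.ge b) :
    ν.symb a x * ν.symb b y = ν.symb (a + b) ⟨x.1 * y.1, ν.mul_mem_ge x.2 y.2⟩ :=
  ν.ofLeaf_mul a b x y

theorem symb_one : ν.symb 0 ⟨1, ν.one_mem_ge⟩ = 1 := rfl

theorem symb_eq_zero {a : Γ} {x : ν.ge a} (hx : x.1 ∈ ν.gt a) : ν.symb a x = 0 := by
  rw [symb, LinearMap.comp_apply, (ν.cls_eq_zero a x).2 hx, map_zero]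

/-- The classes in different degrees are independent. -/
theorem mem_gt_of_sum_symb_eq_zero {t : Finset Γ} {x : ∀ a, ν.ge a}
    (h : ∑ a ∈ t, ν.symb a (x a) = 0) {a : Γ} (ha : a ∈ t) : (x a).1 ∈ ν.gt a := by
  classical
  rw [← ν.cls_eq_zero]
  let c : ν.Gr →ₗ[K] ν.Leaf a := DirectSum.component K Γ ν.Leaf a
  have h2 := congrArg c h
  rw [map_zero, map_sum, Finset.sum_eq_single a] at h2
  · exact (DirectSum.component.lof_self K a _).symm.trans h2
  · intro b _ hb
    show DirectSum.component K Γ ν.Leaf a (DirectSum.lof K Γ ν.Leaf b (ν.cls b (x b))) = 0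
    rw [DirectSum.component.of, dif_neg fun h => hb h]
  · exact fun h => absurd ha h

/-- The associated graded algebra is spanned by classes. -/
theorem gr_induction {p : ν.Gr → Prop} (h0 : p 0) (hs : ∀ a x, p (ν.symb a x))
    (hadd : ∀ x y, p x → p y → p (x + y)) (z : ν.Gr) : p z := by
  classical
  refine DirectSum.induction_on (motive := fun z : DirectSum Γ ν.Leaf => p z) z h0 ?_ hadd
  intro a z
  obtain ⟨x, rfl⟩ := ν.cls_surjective a z
  exact hs a x

end QuasiValuation

section WeightPart
variable {d : ℕ} (K : Type u) [Field K] {A : Finset (Fin d → ℤ)} {N : ℕ}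
  (Ψ : Matrix (Fin N) A ℚ)

/-- The part of weight `a` of a polynomial. -/
def weightPart (a : Lex (Fin N → ℚ)) (p : MvPolynomial A K) : MvPolynomial A K :=
  ∑ α ∈ p.support with weight Ψ α = a, MvPolynomial.monomial α (p.coeff α)

theorem coeff_weightPart (a : Lex (Fin N → ℚ)) (p : MvPolynomial A K) (α : A →₀ ℕ) :
    (weightPart K Ψ a p).coeff α = if weight Ψ α = a then p.coeff α else 0 := by
  classical
  rw [weightPart, MvPolynomial.coeff_sum]
  simp only [MvPolynomial.coeff_monomial, Finset.sum_ite_eq', Finset.mem_filter]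
  by_cases h : weight Ψ α = a <;> simp [h, eq_comm]

theorem sum_weightPart (p : MvPolynomial A K) :
    ∑ a ∈ p.support.image (weight Ψ), weightPart K Ψ a p = p := by
  classical
  ext α
  rw [MvPolynomial.coeff_sum]
  simp only [coeff_weightPart, Finset.sum_ite_eq]
  split_ifs with h
  · rfl
  · by_contra h0
    exact h (Finset.mem_image_of_mem _ (MvPolynomial.mem_support_iff.2 (Ne.symm h0)))

end WeightPart

section Gr
attribute [local instance] MvPolynomial.gradedAlgebra

variable {d : ℕ} (K : Type u) [Field K] [Infinite K] {A : Finset (Fin d → ℤ)} {N : ℕ}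
  (Ψ : Matrix (Fin N) A ℚ)

theorem weight_zero : weight Ψ (0 : A →₀ ℕ) = 0 := by
  have := weight_add Ψ (0 : A →₀ ℕ) 0
  simpa using this

/-- A polynomial all of whose exponents have weight at least `a` restricts to `F_{≥ a}`. -/
theorem mk_mem_ge {p : MvPolynomial A K} {a : Lex (Fin N → ℚ)}
    (h : ∀ α, p.coeff α ≠ 0 → a ≤ weight Ψ α) :
    Ideal.Quotient.mk (toricIdeal K A) p ∈ (nu (K := K) Ψ).ge a :=
  ((le_weightVal Ψ).2 fun α hα => WithTop.coe_le_coe.2 (h α hα)).trans (le_nuVal Ψ p)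

theorem mk_monomial_mem_ge (α : A →₀ ℕ) (c : K) :
    Ideal.Quotient.mk (toricIdeal K A) (MvPolynomial.monomial α c) ∈
      (nu (K := K) Ψ).ge (weight Ψ α) := by
  classical
  refine mk_mem_ge K Ψ fun β hβ => ?_
  rw [MvPolynomial.coeff_monomial] at hβ
  rw [(ite_ne_right_iff.1 hβ).1]

/-- The homomorphism `K[x_χ ∣ χ ∈ A] → gr_{ν_Ψ} K[X̂_A]` which sends `x_χ` to its class in degree
`Ψ(χ)`. -/
def grHom : MvPolynomial A K →ₐ[K] (nu (K := K) Ψ).Gr :=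
  MvPolynomial.aeval fun χ => (nu (K := K) Ψ).symb (weight Ψ (Finsupp.single χ 1))
    ⟨_, mk_monomial_mem_ge K Ψ (Finsupp.single χ 1) 1⟩

/-- The image of a monomial is its class in the degree given by its weight. -/
theorem grHom_monomial (α : A →₀ ℕ) (c : K) : grHom K Ψ (MvPolynomial.monomial α c) =
    (nu (K := K) Ψ).symb (weight Ψ α) ⟨_, mk_monomial_mem_ge K Ψ α c⟩ := by
  have hadd : ∀ α β : A →₀ ℕ,
      grHom K Ψ (MvPolynomial.monomial α 1) =
        (nu (K := K) Ψ).symb (weight Ψ α) ⟨_, mk_monomial_mem_ge K Ψ α 1⟩ →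
      grHom K Ψ (MvPolynomial.monomial β 1) =
        (nu (K := K) Ψ).symb (weight Ψ β) ⟨_, mk_monomial_mem_ge K Ψ β 1⟩ →
      grHom K Ψ (MvPolynomial.monomial (α + β) 1) =
        (nu (K := K) Ψ).symb (weight Ψ (α + β)) ⟨_, mk_monomial_mem_ge K Ψ (α + β) 1⟩ := by
    intro α β hα hβ
    have h : (MvPolynomial.monomial (α + β) (1 : K)) =
        MvPolynomial.monomial α 1 * MvPolynomial.monomial β 1 := by
      rw [MvPolynomial.monomial_mul, one_mul]
    refine (congrArg (grHom K Ψ) h).trans ?_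
    rw [map_mul, hα, hβ, QuasiValuation.symb_mul]
    refine QuasiValuation.symb_congr _ _ _ (weight_add Ψ α β).symm ?_
    rw [h, map_mul]
  have hzero : grHom K Ψ (MvPolynomial.monomial 0 1) =
      (nu (K := K) Ψ).symb (weight Ψ 0) ⟨_, mk_monomial_mem_ge K Ψ 0 1⟩ := by
    refine (map_one (grHom K Ψ)).trans ?_
    rw [← QuasiValuation.symb_one]
    exact QuasiValuation.symb_congr _ _ _ (weight_zero Ψ).symm rfl
  have h1 : grHom K Ψ (MvPolynomial.monomial α 1) =
      (nu (K := K) Ψ).symb (weight Ψ α) ⟨_, mk_monomial_mem_ge K Ψ α 1⟩ := by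
    induction α using Finsupp.induction_linear with
    | zero => exact hzero
    | add α β hα hβ => exact hadd α β hα hβ
    | single χ n =>
      induction n with
      | zero =>
        have h : Finsupp.single χ 0 = (0 : A →₀ ℕ) := Finsupp.single_zero χ
        refine (congrArg (fun α => grHom K Ψ (MvPolynomial.monomial α 1)) h).trans
          (hzero.trans ?_)
        exact QuasiValuation.symb_congr _ _ _ (congrArg _ h.symm) (by rw [h])
      | succ n ih =>
        have h := Finsupp.single_add χ n 1
        refine (congrArg (fun α => grHom K Ψ (MvPolynomial.monomial α 1)) h).trans
          ((hadd _ _ ih (MvPolynomial.aeval_X _ χ)).trans ?_)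
        exact QuasiValuation.symb_congr _ _ _ (congrArg _ h.symm) (by rw [h])
  have h2 : (MvPolynomial.monomial α c) = c • MvPolynomial.monomial α (1 : K) := by
    rw [MvPolynomial.smul_monomial, smul_eq_mul, mul_one]
  refine (congrArg (grHom K Ψ) h2).trans ?_
  rw [map_smul, h1, ← map_smul]
  refine QuasiValuation.symb_congr _ _ _ rfl ?_
  rw [h2]
  rfl

theorem mk_weightPart_mem_ge (a : Lex (Fin N → ℚ)) (p : MvPolynomial A K) :
    Ideal.Quotient.mk (toricIdeal K A) (weightPart K Ψ a p) ∈ (nu (K := K) Ψ).ge a := by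
  refine mk_mem_ge K Ψ fun α hα => ?_
  rw [coeff_weightPart] at hα
  exact (ite_ne_right_iff.1 hα).1.ge

theorem grHom_weightPart (a : Lex (Fin N → ℚ)) (p : MvPolynomial A K) :
    grHom K Ψ (weightPart K Ψ a p) =
      (nu (K := K) Ψ).symb a ⟨_, mk_weightPart_mem_ge K Ψ a p⟩ := by
  have hmem : ∀ α : {α // α ∈ p.support.filter fun α => weight Ψ α = a},
      Ideal.Quotient.mk (toricIdeal K A) (MvPolynomial.monomial α.1 (p.coeff α.1)) ∈
        (nu (K := K) Ψ).ge a := by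
    intro α
    have h := mk_monomial_mem_ge K Ψ α.1 (p.coeff α.1)
    rwa [(Finset.mem_filter.1 α.2).2] at h
  have hp : weightPart K Ψ a p = ∑ α ∈ (p.support.filter fun α => weight Ψ α = a).attach,
      MvPolynomial.monomial α.1 (p.coeff α.1) :=
    (Finset.sum_attach _ fun α => MvPolynomial.monomial α (p.coeff α)).symm
  have h : (⟨_, mk_weightPart_mem_ge K Ψ a p⟩ : (nu (K := K) Ψ).ge a) =
      ∑ α ∈ (p.support.filter fun α => weight Ψ α = a).attach, ⟨_, hmem α⟩ := by
    apply Subtype.ext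
    rw [Submodule.coe_sum]
    exact (congrArg (Ideal.Quotient.mk (toricIdeal K A)) hp).trans (map_sum _ _ _)
  rw [h, map_sum]
  refine (congrArg (grHom K Ψ) hp).trans ?_
  rw [map_sum]
  refine Finset.sum_congr rfl fun α _ => ?_
  rw [grHom_monomial]
  exact QuasiValuation.symb_congr _ _ _ (Finset.mem_filter.1 α.2).2 rfl

/-- By the definition of the quasi-valuation, an element of value at least `a` lifts to a polynomial
with weights at least `a`; its class in degree `a` is that of the part of weight `a`. -/
theorem grHom_surjective : Function.Surjective (grHom K Ψ) := by
  intro z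
  show z ∈ (grHom K Ψ).range
  induction z using QuasiValuation.gr_induction with
  | h0 => exact Subalgebra.zero_mem _
  | hadd x y hx hy => exact Subalgebra.add_mem _ hx hy
  | hs a x =>
    obtain ⟨x, hx⟩ := x
    obtain ⟨p, rfl, hp⟩ := exists_lift Ψ x
    refine ⟨weightPart K Ψ a p, (grHom_weightPart K Ψ a p).trans ?_⟩
    rw [← sub_eq_zero, ← map_sub]
    apply QuasiValuation.symb_eq_zero
    show Ideal.Quotient.mk (toricIdeal K A) (weightPart K Ψ a p) - Ideal.Quotient.mk _ p ∈ _
    rw [← map_sub]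
    show (a : WithTop (Lex (Fin N → ℚ))) < nuVal Ψ _
    refine lt_of_lt_of_le ?_ (le_nuVal Ψ _)
    rw [weightVal, Finset.lt_inf_iff (WithTop.coe_lt_top a)]
    intro α hα
    rw [MvPolynomial.mem_support_iff, MvPolynomial.coeff_sub, coeff_weightPart] at hα
    have hα0 : p.coeff α ≠ 0 := by
      rintro h
      simp [h] at hα
    refine lt_of_le_of_ne ((show _ ≤ nuVal Ψ _ from hx).trans
      (hp.symm.le.trans (weightVal_le Ψ hα0))) fun h => ?_
    rw [if_pos (WithTop.coe_injective h).symm, sub_self] at hα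
    exact hα rfl

/-- If `p` is in the kernel of `grHom`, then any of its weighted homogeneous parts is, modulo the
toric ideal, equal to a polynomial of higher weight. -/
theorem exists_lift_of_grHom_eq_zero {p : MvPolynomial A K} (hp : grHom K Ψ p = 0)
    (a : Lex (Fin N → ℚ)) : ∃ q : MvPolynomial A K, weightPart K Ψ a p - q ∈ toricIdeal K A ∧
      ∀ α, q.coeff α ≠ 0 → a < weight Ψ α := by
  classical
  by_cases ha : a ∈ p.support.image (weight Ψ)
  · rw [← sum_weightPart K Ψ p, map_sum] at hp
    simp only [grHom_weightPart] at hp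
    have h := (nu (K := K) Ψ).mem_gt_of_sum_symb_eq_zero
      (x := fun a => ⟨_, mk_weightPart_mem_ge K Ψ a p⟩) hp ha
    obtain ⟨q, hq, hq'⟩ := exists_lift Ψ (Ideal.Quotient.mk (toricIdeal K A) (weightPart K Ψ a p))
    refine ⟨q, Ideal.Quotient.eq.1 hq.symm, fun α hα => ?_⟩
    exact WithTop.coe_lt_coe.1 ((show _ < nuVal Ψ _ from h).trans_le
      (hq'.symm.le.trans (weightVal_le Ψ hα)))
  · refine ⟨0, ?_, by simp⟩
    have : weightPart K Ψ a p = 0 := by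
      rw [weightPart, Finset.sum_eq_zero]
      intro α hα
      exact absurd (Finset.mem_image.2 ⟨α, (Finset.mem_filter.1 hα).1, (Finset.mem_filter.1 hα).2⟩)
        ha
    rw [this, sub_zero]
    exact Ideal.zero_mem _

/-- The homomorphism `K[x_χ ∣ χ ∈ A] → Red(gr_{ν_Ψ} K[X̂_A])`. -/
def redHom : MvPolynomial A K →ₐ[K] (nu (K := K) Ψ).RedGr :=
  (Ideal.Quotient.mkₐ K (nilradical (nu (K := K) Ψ).Gr)).comp (grHom K Ψ)

theorem redHom_surjective : Function.Surjective (redHom K Ψ) :=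
  (Ideal.Quotient.mkₐ_surjective K _).comp (grHom_surjective K Ψ)

theorem mem_ker_redHom {p : MvPolynomial A K} :
    p ∈ RingHom.ker (redHom K Ψ) ↔ ∃ n, grHom K Ψ (p ^ n) = 0 := by
  rw [RingHom.mem_ker]
  refine Ideal.Quotient.eq_zero_iff_mem.trans ?_
  simp only [map_pow]
  exact mem_nilradical

theorem redHom_mem (m : ℕ) (p : MvPolynomial A K)
    (hp : p ∈ MvPolynomial.homogeneousSubmodule A K m) :
    redHom K Ψ p ∈ nuGrading (K := K) Ψ m := by
  refine ⟨grHom K Ψ p, ?_, rfl⟩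
  rw [p.as_sum, map_sum]
  refine Submodule.sum_mem _ fun α hα => ?_
  rw [grHom_monomial]
  refine Submodule.subset_span ⟨weight Ψ α, _, ⟨_, ?_, rfl⟩, rfl⟩
  refine (MvPolynomial.mem_homogeneousSubmodule _ _).2 (MvPolynomial.isHomogeneous_monomial _ ?_)
  rw [Finsupp.degree_eq_weight_one]
  exact (MvPolynomial.mem_homogeneousSubmodule m p).1 hp (MvPolynomial.mem_support_iff.1 hα)

instance : IsReduced (nu (K := K) Ψ).RedGr :=
  (Ideal.isRadical_iff_quotient_reduced _).1
    (Ideal.radical_isRadical (⊥ : Ideal (nu (K := K) Ψ).Gr))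

end Gr

/-! ### The kernel of the map to the reduced associated graded algebra -/

/-- The inclusion of `ℚ^N` into `ℝ^N`, both ordered lexicographically. -/
def lexCast (N : ℕ) : Lex (Fin N → ℚ) →+ Lex (Fin N → ℝ) where
  toFun a := toLex fun k => (ofLex a k : ℝ)
  map_zero' := by
    apply ofLex.injective
    funext k
    exact Rat.cast_zero
  map_add' a b := by
    apply ofLex.injective
    funext k
    exact Rat.cast_add _ _

theorem lexCast_strictMono (N : ℕ) : StrictMono (lexCast N) := by
  rintro a b ⟨i, hi, hlt⟩
  exact ⟨i, fun j hj => congrArg Rat.cast (hi j hj), Rat.cast_lt.2 hlt⟩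

section Supporting
variable {d : ℕ} {A : Finset (Fin d → ℤ)} {N : ℕ}

/-- The additive map `u` lies above the columns of `Ψ`, and it agrees with the column of `χ`
exactly for `χ ∈ s`. -/
def IsSupporting (Ψ : Matrix (Fin N) A ℚ) (s : Finset (Fin d → ℤ))
    (u : ℕ × (Fin d → ℤ) →+ Lex (Fin N → ℝ)) : Prop :=
  ∀ χ : A, (toLex fun k => (Ψ k χ : ℝ)) ≤ u (1, χ.1) ∧
    ((toLex fun k => (Ψ k χ : ℝ)) = u (1, χ.1) ↔ χ.1 ∈ s)

theorem lexCast_weight (Ψ : Matrix (Fin N) A ℚ) (α : A →₀ ℕ) :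
    lexCast N (weight Ψ α) = ∑ χ, α χ • (toLex fun k => (Ψ k χ : ℝ)) := by
  apply ofLex.injective
  funext k
  have h : ofLex (∑ χ, α χ • (toLex fun k => (Ψ k χ : ℝ))) k = ∑ χ, α χ • (Ψ k χ : ℝ) :=
    Finset.sum_apply k Finset.univ fun χ => α χ • fun k => (Ψ k χ : ℝ)
  rw [h]
  show ((∑ χ, Ψ k χ * (α χ : ℚ) : ℚ) : ℝ) = _
  push_cast
  exact Finset.sum_congr rfl fun χ _ => by rw [nsmul_eq_mul, mul_comm]

variable {Ψ : Matrix (Fin N) A ℚ} {s : Finset (Fin d → ℤ)}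
  {u : ℕ × (Fin d → ℤ) →+ Lex (Fin N → ℝ)}

theorem map_mdeg (u : ℕ × (Fin d → ℤ) →+ Lex (Fin N → ℝ)) (α : A →₀ ℕ) :
    u (mdeg A α) = ∑ χ : A, α χ • u (1, χ.1) := by
  rw [mdeg_apply, map_sum]
  simp only [map_nsmul]

theorem IsSupporting.weight_le (hu : IsSupporting Ψ s u) (α : A →₀ ℕ) :
    lexCast N (weight Ψ α) ≤ u (mdeg A α) := by
  rw [lexCast_weight, map_mdeg]
  exact Finset.sum_le_sum fun χ _ => nsmul_le_nsmul_right (hu χ).1 _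

/-- The exponents supported in `s` are those whose weight attains the upper bound given by `u`. -/
theorem IsSupporting.weight_eq_iff (hu : IsSupporting Ψ s u) (α : A →₀ ℕ) :
    lexCast N (weight Ψ α) = u (mdeg A α) ↔ SuppIn s α := by
  constructor
  · intro h χ hχ
    by_contra hs
    refine h.not_lt ?_
    rw [lexCast_weight, map_mdeg]
    refine Finset.sum_lt_sum (fun χ _ => nsmul_le_nsmul_right (hu χ).1 _)
      ⟨χ, Finset.mem_univ _, ?_⟩
    exact nsmul_lt_nsmul_right (Finsupp.mem_support_iff.1 hχ)
      (lt_of_le_of_ne (hu χ).1 fun h => hs ((hu χ).2.1 h))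
  · intro h
    rw [lexCast_weight, map_mdeg]
    refine Finset.sum_congr rfl fun χ _ => ?_
    by_cases hχ : α χ = 0
    · rw [hχ, zero_nsmul, zero_nsmul]
    · rw [(hu χ).2.2 (h χ (Finsupp.mem_support_iff.2 hχ))]

end Supporting

section Kernel
variable {d : ℕ} {K : Type u} [Field K] [CharZero K] {A : Finset (Fin d → ℤ)} {N : ℕ}
  {Ψ : Matrix (Fin N) A ℚ} {s : Finset (Fin d → ℤ)} {u : ℕ × (Fin d → ℤ) →+ Lex (Fin N → ℝ)}

/-- Monomials of the same multidegree agree on the torus. -/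
theorem mk_monomial_eq {α β : A →₀ ℕ} (h : mdeg A α = mdeg A β) (c : K) :
    Ideal.Quotient.mk (toricIdeal K A) (MvPolynomial.monomial α c) =
      Ideal.Quotient.mk (toricIdeal K A) (MvPolynomial.monomial β c) := by
  have hA : ∀ α : A →₀ ℕ, SuppIn A α := fun α χ _ => χ.2
  rw [Ideal.Quotient.eq, toricIdeal_eq_ker, RingHom.mem_ker,
    ← map_eq_zero_iff _ (cellIncl_injective K A), map_sub, map_sub, cellIncl_cellHom_monomial,
    cellIncl_cellHom_monomial, if_pos (hA α), if_pos (hA β), h, sub_self]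

/-- For a monomial with exponents in `s`, any other monomial of the same multidegree has the same
class in the associated graded algebra if its exponents are in `s`, and is `0` otherwise. -/
theorem IsSupporting.grHom_monomial_eq (hu : IsSupporting Ψ s u) {α β : A →₀ ℕ}
    (h : mdeg A α = mdeg A β) (hβ : SuppIn s β) (c : K) :
    grHom K Ψ (MvPolynomial.monomial α c) =
      open Classical in if SuppIn s α then grHom K Ψ (MvPolynomial.monomial β c) else 0 := by
  have hw := (hu.weight_eq_iff β).2 hβ
  rw [← h] at hw
  rw [grHom_monomial, grHom_monomial]
  split_ifs with hα
  · exact QuasiValuation.symb_congr _ _ _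
      ((lexCast_strictMono N).injective (((hu.weight_eq_iff α).2 hα).trans hw.symm))
      (mk_monomial_eq h c)
  · apply QuasiValuation.symb_eq_zero
    have hlt : weight Ψ α < weight Ψ β := by
      refine (lexCast_strictMono N).lt_iff_lt.1 ?_
      rw [hw]
      exact lt_of_le_of_ne (hu.weight_le α) fun h => hα ((hu.weight_eq_iff α).1 h)
    have hge := mk_monomial_mem_ge K Ψ β c
    rw [← mk_monomial_eq h] at hge
    exact (WithTop.coe_lt_coe.2 hlt).trans_le hge

/-- The weighted homogeneous parts of an element of `ker grHom` vanish on the cell. -/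
theorem IsSupporting.weightPart_mem_ker (hu : IsSupporting Ψ s u) {p : MvPolynomial A K}
    (hp : grHom K Ψ p = 0) (a : Lex (Fin N → ℚ)) :
    weightPart K Ψ a p ∈ RingHom.ker (cellHom K A s) := by
  classical
  obtain ⟨q, hq, hq'⟩ := exists_lift_of_grHom_eq_zero K Ψ hp a
  rw [toricIdeal_eq_ker, RingHom.mem_ker, map_sub, sub_eq_zero] at hq
  have hr : ∀ α ∈ (weightPart K Ψ a p).support, weight Ψ α = a := by
    intro α hα
    rw [MvPolynomial.mem_support_iff, coeff_weightPart] at hα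
    exact (ite_ne_right_iff.1 hα).1
  have hA : ∀ α : A →₀ ℕ, SuppIn A α := fun α χ _ => χ.2
  rw [mem_ker_cellHom]
  intro m
  by_cases ha : lexCast N a = u m
  · -- all the exponents of multidegree `m` are in `s`, and none of them occurs in `q`
    have h1 := congrArg (fun f => (cellIncl K f).coeff m) hq
    simp only [coeff_cellIncl_cellHom] at h1
    rw [Finset.sum_eq_zero (s := q.support)] at h1
    · refine Eq.trans (Finset.sum_congr rfl fun α hα => if_congr ?_ rfl rfl) h1
      refine and_congr_left fun hm => iff_of_true ?_ (hA α)
      rw [← hu.weight_eq_iff, hr α hα, ha, hm]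
    · intro α hα
      refine if_neg fun hm => ?_
      have h2 := hu.weight_le α
      rw [hm.2, ← ha, (lexCast_strictMono N).le_iff_le] at h2
      exact h2.not_gt (hq' α (MvPolynomial.mem_support_iff.1 hα))
  · refine Finset.sum_eq_zero fun α hα => if_neg fun hm => ha ?_
    rw [← hr α hα, (hu.weight_eq_iff α).2 hm.1, hm.2]

/-- As `K[S]` is a domain, passing to the quotient by the nilradical does not matter. -/
theorem IsSupporting.ker_redHom_le (hu : IsSupporting Ψ s u) :
    RingHom.ker (redHom K Ψ) ≤ RingHom.ker (cellHom K A s) := by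
  intro p hp
  obtain ⟨n, hn⟩ := (mem_ker_redHom K Ψ).1 hp
  have h : p ^ n ∈ RingHom.ker (cellHom K A s) := by
    rw [← sum_weightPart K Ψ (p ^ n)]
    exact Ideal.sum_mem _ fun a _ => hu.weightPart_mem_ker hn a
  rw [RingHom.mem_ker, map_pow] at h
  exact eq_zero_of_pow_eq_zero h

/-- A polynomial which vanishes on all cells is nilpotent in the associated graded algebra: a
monomial whose exponents are not in a common cell has a power which is, modulo the toric ideal,
equal to a monomial of higher weight. -/
theorem iInf_ker_cellHom_le {cells : Finset (Finset (Fin d → ℤ))}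
    (hcells : ∀ s ∈ cells, ∃ u, IsSupporting Ψ s u)
    (hcover : ∀ α : A →₀ ℕ, ∃ s ∈ cells, ∃ k : ℕ, k ≠ 0 ∧ ∃ β : A →₀ ℕ,
      SuppIn s β ∧ mdeg A β = k • mdeg A α) :
    ⨅ s ∈ cells, RingHom.ker (cellHom K A s) ≤ RingHom.ker (redHom K Ψ) := by
  classical
  intro p hp
  simp only [Ideal.mem_iInf] at hp
  rw [RingHom.mem_ker]
  conv_lhs => rw [p.as_sum]
  rw [map_sum, ← Finset.sum_fiberwise_of_maps_to (t := p.support.image (mdeg A)) (g := mdeg A)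
    fun α hα => Finset.mem_image_of_mem _ hα]
  refine Finset.sum_eq_zero fun m _ => ?_
  by_cases h : ∃ s ∈ cells, ∃ β : A →₀ ℕ, SuppIn s β ∧ mdeg A β = m
  · obtain ⟨s, hs, β, hβ, rfl⟩ := h
    obtain ⟨u, hu⟩ := hcells s hs
    have h1 : ∀ α ∈ p.support.filter fun α => mdeg A α = mdeg A β,
        redHom K Ψ (MvPolynomial.monomial α (p.coeff α)) =
          (if SuppIn s α then p.coeff α else 0) • redHom K Ψ (MvPolynomial.monomial β 1) := by
      intro α hα
      have h := hu.grHom_monomial_eq (K := K) (Finset.mem_filter.1 hα).2 hβ (p.coeff α)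
      split_ifs at h ⊢
      · rw [← map_smul, MvPolynomial.smul_monomial, smul_eq_mul, mul_one]
        exact congrArg (Ideal.Quotient.mkₐ K (nilradical (nu (K := K) Ψ).Gr)) h
      · rw [zero_smul]
        exact (congrArg (Ideal.Quotient.mkₐ K (nilradical (nu (K := K) Ψ).Gr)) h).trans
          (map_zero _)
    rw [Finset.sum_congr rfl h1, ← Finset.sum_smul, Finset.sum_filter]
    have h2 := (mem_ker_cellHom K A s).1 (hp s hs) (mdeg A β)
    have h3 : (∑ α ∈ p.support, if mdeg A α = mdeg A β then
        (if SuppIn s α then p.coeff α else 0) else 0) = 0 := by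
      refine Eq.trans (Finset.sum_congr rfl fun α _ => ?_) h2
      by_cases h4 : mdeg A α = mdeg A β <;> by_cases h5 : SuppIn s α <;> simp [h4, h5]
    rw [h3, zero_smul]
  · refine Finset.sum_eq_zero fun α hα => ?_
    obtain ⟨s, hs, k, hk, β, hβ, hm⟩ := hcover α
    obtain ⟨u, hu⟩ := hcells s hs
    have hα' : ¬ SuppIn s α := fun hα' => h ⟨s, hs, α, hα', (Finset.mem_filter.1 hα).2⟩
    have hk' : ¬ SuppIn s (k • α) := by
      intro hkα
      refine hα' fun χ hχ => hkα χ ?_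
      rw [Finsupp.mem_support_iff] at hχ ⊢
      exact mul_ne_zero hk hχ
    have h1 := hu.grHom_monomial_eq (α := k • α) (by rw [map_nsmul, hm]) hβ (p.coeff α ^ k)
    rw [if_neg hk', ← MvPolynomial.monomial_pow] at h1
    exact (mem_ker_redHom K Ψ).2 ⟨k, h1⟩

theorem ker_redHom_eq {cells : Finset (Finset (Fin d → ℤ))}
    (hcells : ∀ s ∈ cells, ∃ u, IsSupporting Ψ s u)
    (hcover : ∀ α : A →₀ ℕ, ∃ s ∈ cells, ∃ k : ℕ, k ≠ 0 ∧ ∃ β : A →₀ ℕ,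
      SuppIn s β ∧ mdeg A β = k • mdeg A α) :
    RingHom.ker (redHom K Ψ) = ⨅ s ∈ cells, RingHom.ker (cellHom K A s) := by
  refine le_antisymm (le_iInf₂ fun s hs => ?_) (iInf_ker_cellHom_le hcells hcover)
  obtain ⟨u, hu⟩ := hcells s hs
  exact hu.ker_redHom_le

end Kernel

/-! ### Rational points of lattice polytopes -/

theorem latticePt_injective {d : ℕ} : Function.Injective (latticePt (d := d)) := by
  intro m n h
  funext i
  exact Int.cast_injective (α := ℝ) (congrFun h i)

/-- The coefficients of a rational point with respect to affinely independent rational points are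
rational: they are fixed by any `ℚ`-linear retraction of `ℝ` onto `ℚ`. -/
theorem exists_rat_of_affineIndependent {d : ℕ} {t : Finset (Fin d → ℝ)}
    (ht : AffineIndependent ℝ ((↑) : t → Fin d → ℝ)) (htr : ∀ y ∈ t, ∀ i, ∃ z : ℚ, y i = z)
    {x : Fin d → ℝ} (hx : ∀ i, ∃ z : ℚ, x i = z) {w : (Fin d → ℝ) → ℝ}
    (hw : ∑ y ∈ t, w y = 1) (hwx : ∑ y ∈ t, w y • y = x) {y : Fin d → ℝ} (hy : y ∈ t) :
    ∃ z : ℚ, w y = z := by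
  obtain ⟨f, hf⟩ := LinearMap.exists_leftInverse_of_injective (Algebra.linearMap ℚ ℝ)
    (LinearMap.ker_eq_bot.2 (algebraMap ℚ ℝ).injective)
  have hf1 : ∀ z : ℚ, f z = z := fun z => LinearMap.congr_fun hf z
  have hf2 : ∀ (r : ℝ) (z : ℚ), f (r * z) = f r * z := by
    intro r z
    rw [mul_comm, mul_comm (f r), ← Rat.smul_def, map_smul, smul_eq_mul]
  have h := affineIndependent_iff.1 ht Finset.univ (fun y => w y - (f (w y) : ℝ)) ?_ ?_
    ⟨y, hy⟩ (Finset.mem_univ _)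
  · exact ⟨f (w y), sub_eq_zero.1 h⟩
  · rw [Finset.sum_sub_distrib, Finset.sum_coe_sort t w,
      Finset.sum_coe_sort t fun y => (f (w y) : ℝ), ← Rat.cast_sum, ← map_sum, hw]
    have := hf1 1
    rw [Rat.cast_one] at this
    rw [this, Rat.cast_one, sub_self]
  · rw [Finset.sum_coe_sort t fun y => (w y - (f (w y) : ℝ)) • y]
    simp only [sub_smul]
    rw [Finset.sum_sub_distrib, hwx, sub_eq_zero]
    funext i
    obtain ⟨z, hz⟩ := hx i
    have h1 := congrFun hwx i
    rw [Finset.sum_apply] at h1 ⊢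
    have h2 : ∀ y ∈ t, ((f (w y) : ℝ) • y) i = (f (w y * y i) : ℝ) := by
      intro y hy
      obtain ⟨z, hz⟩ := htr y hy i
      rw [hz, hf2, Pi.smul_apply, hz, smul_eq_mul, Rat.cast_mul]
    rw [Finset.sum_congr rfl h2, ← Rat.cast_sum, ← map_sum]
    simp only [Pi.smul_apply, smul_eq_mul] at h1
    rw [h1, hz, hf1]

/-- A rational point of a lattice polytope is a rational convex combination of the generators. -/
theorem exists_rat_weights {d : ℕ} {s : Finset (Fin d → ℤ)} {x : Fin d → ℝ}
    (hx : ∀ i, ∃ z : ℚ, x i = z) (hxs : x ∈ polytope s) :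
    ∃ w : (Fin d → ℤ) → ℚ, (∀ χ, 0 ≤ w χ) ∧ ∑ χ ∈ s, w χ = 1 ∧
      ∑ χ ∈ s, (w χ : ℝ) • latticePt χ = x := by
  classical
  rw [polytope, convexHull_eq_union] at hxs
  simp only [Set.mem_iUnion] at hxs
  obtain ⟨t, hts, hind, hxt⟩ := hxs
  rw [Finset.mem_convexHull'] at hxt
  obtain ⟨w, hw0, hw1, hwx⟩ := hxt
  have htr : ∀ y ∈ t, ∀ i, ∃ z : ℚ, y i = z := by
    intro y hy i
    obtain ⟨m, _, rfl⟩ := hts hy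
    exact ⟨m i, by simp [latticePt]⟩
  have hr : ∀ y : Fin d → ℝ, ∃ z : ℚ, y ∈ t → w y = z := by
    intro y
    by_cases hy : y ∈ t
    · obtain ⟨z, hz⟩ := exists_rat_of_affineIndependent hind htr hx hw1 hwx hy
      exact ⟨z, fun _ => hz⟩
    · exact ⟨0, fun h => absurd h hy⟩
  choose r hr using hr
  have ht : t = (s.filter fun χ => latticePt χ ∈ t).image latticePt := by
    ext y
    simp only [Finset.mem_image, Finset.mem_filter]
    constructor
    · intro hy
      obtain ⟨m, hm, rfl⟩ := hts hy
      exact ⟨m, ⟨hm, hy⟩, rfl⟩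
    · rintro ⟨m, hm, rfl⟩
      exact hm.2
  have hsum : ∀ {E : Type} [AddCommMonoid E] (F : (Fin d → ℝ) → E),
      ∑ χ ∈ s, (if latticePt χ ∈ t then F (latticePt χ) else 0) = ∑ y ∈ t, F y := by
    intro E _ F
    rw [← Finset.sum_filter]
    conv_rhs => rw [ht]
    rw [Finset.sum_image latticePt_injective.injOn]
  refine ⟨fun χ => if latticePt χ ∈ t then r (latticePt χ) else 0, fun χ => ?_, ?_, ?_⟩
  · dsimp only
    split_ifs with h
    · have := hw0 _ h
      rw [hr _ h] at this
      exact_mod_cast this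
    · exact le_rfl
  · rw [hsum r]
    have : ((∑ y ∈ t, r y : ℚ) : ℝ) = 1 := by
      rw [Rat.cast_sum, ← hw1]
      exact Finset.sum_congr rfl fun y hy => (hr y hy).symm
    exact_mod_cast this
  · rw [← hwx, ← hsum]
    refine Finset.sum_congr rfl fun χ _ => ?_
    dsimp only
    split_ifs with h
    · rw [hr _ h]
    · rw [Rat.cast_zero, zero_smul]

theorem exists_common_denominator {ι : Type*} (s : Finset ι) (w : ι → ℚ) (hw : ∀ i, 0 ≤ w i) :
    ∃ k : ℕ, k ≠ 0 ∧ ∃ n : ι → ℕ, ∀ i ∈ s, (n i : ℚ) = k * w i := by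
  classical
  have h : ∀ i, ∃ m : ℕ, i ∈ s → (m : ℚ) = ((∏ i ∈ s, (w i).den : ℕ) : ℚ) * w i := by
    intro i
    by_cases hi : i ∈ s
    · refine ⟨(∏ j ∈ s.erase i, (w j).den) * (w i).num.toNat, fun _ => ?_⟩
      have h1 : (((w i).num.toNat : ℕ) : ℚ) = (w i).den * w i := by
        rw [mul_comm, Rat.mul_den_eq_num]
        exact_mod_cast Int.toNat_of_nonneg (Rat.num_nonneg.2 (hw i))
      rw [← Finset.mul_prod_erase s _ hi]
      push_cast
      rw [h1]
      ring
    · exact ⟨0, fun h => absurd h hi⟩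
  choose n hn using h
  exact ⟨_, Finset.prod_ne_zero_iff.2 fun i _ => (w i).den_nz, n, hn⟩

/-- A nonzero multiple of any multidegree is the multidegree of an exponent supported in a cell. -/
theorem exists_suppIn_mdeg_eq_nsmul {d : ℕ} {A : Finset (Fin d → ℤ)}
    {cells : Finset (Finset (Fin d → ℤ))} (hsub : ∀ s ∈ cells, s ⊆ A)
    (hcover : polytope A ⊆ ⋃ s ∈ cells, polytope s) (hne : cells.Nonempty) (α : A →₀ ℕ) :
    ∃ s ∈ cells, ∃ k : ℕ, k ≠ 0 ∧ ∃ β : A →₀ ℕ, SuppIn s β ∧ mdeg A β = k • mdeg A α := by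
  classical
  by_cases hα : α.degree = 0
  · obtain ⟨s, hs⟩ := hne
    rw [Finsupp.degree_eq_zero_iff] at hα
    exact ⟨s, hs, 1, one_ne_zero, 0, fun χ hχ => by simp at hχ, by rw [hα, one_nsmul]⟩
  have hn : (α.degree : ℝ) ≠ 0 := Nat.cast_ne_zero.2 hα
  have hn' : (α.degree : ℝ) = ∑ χ : A, (α χ : ℝ) := by
    rw [Finsupp.degree_eq_sum, Nat.cast_sum]
  -- the barycentre of the exponent
  let x : Fin d → ℝ := ∑ χ : A, ((α χ : ℝ) / α.degree) • latticePt χ.1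
  have hxA : x ∈ polytope A := by
    refine (convex_convexHull ℝ _).sum_mem (fun χ _ => by positivity) ?_
      fun χ _ => subset_convexHull ℝ _ ⟨χ.1, χ.2, rfl⟩
    rw [← Finset.sum_div, ← hn', div_self hn]
  have hxr : ∀ i, x i = ((mdeg A α).2 i : ℝ) / α.degree := by
    intro i
    refine (Finset.sum_apply i _ _).trans ?_
    rw [mdeg_apply, Prod.snd_sum, Finset.sum_apply, Int.cast_sum, Finset.sum_div]
    refine Finset.sum_congr rfl fun χ _ => ?_
    simp [latticePt]
    ring
  obtain ⟨s, hs, hxs⟩ := Set.mem_iUnion₂.1 (hcover hxA)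
  obtain ⟨w, hw0, hw1, hwx⟩ := exists_rat_weights (fun i => ⟨(mdeg A α).2 i / α.degree, by
    rw [hxr]; push_cast; rfl⟩) hxs
  obtain ⟨k, hk, n, hnk⟩ := exists_common_denominator s w hw0
  let β : A →₀ ℕ := Finsupp.equivFunOnFinite.symm fun χ =>
    if χ.1 ∈ s then α.degree * n χ.1 else 0
  have hβ : ∀ χ, β χ = if χ.1 ∈ s then α.degree * n χ.1 else 0 := fun χ => rfl
  have hsum : ∀ {E : Type} [AddCommMonoid E] (F : (Fin d → ℤ) → E),
      ∑ χ : A, (if χ.1 ∈ s then F χ.1 else 0) = ∑ χ ∈ s, F χ := by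
    intro E _ F
    rw [Finset.sum_coe_sort A fun χ => if χ ∈ s then F χ else 0, ← Finset.sum_filter,
      Finset.filter_mem_eq_inter, Finset.inter_eq_right.2 (hsub s hs)]
  refine ⟨s, hs, k, hk, β, fun χ hχ => ?_, ?_⟩
  · by_contra h
    exact Finsupp.mem_support_iff.1 hχ ((hβ χ).trans (if_neg h))
  · have h0 : ∑ χ ∈ s, n χ = k := by
      have : ((∑ χ ∈ s, n χ : ℕ) : ℚ) = k := by
        rw [Nat.cast_sum, Finset.sum_congr rfl hnk, ← Finset.mul_sum, hw1, mul_one]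
      exact_mod_cast this
    refine Prod.ext ?_ (funext fun i => ?_)
    · rw [Prod.smul_fst, mdeg_fst, mdeg_fst, Finsupp.degree_eq_sum]
      simp only [hβ]
      rw [hsum fun χ => α.degree * n χ, ← Finset.mul_sum, h0, smul_eq_mul, mul_comm]
    · have h1 := congrFun hwx i
      rw [hxr, eq_div_iff hn, Finset.sum_apply] at h1
      have h2 : (((mdeg A β).2 i : ℤ) : ℝ) = (((k • mdeg A α).2 i : ℤ) : ℝ) := by
        rw [Prod.smul_snd, Pi.smul_apply, nsmul_eq_mul, Int.cast_mul, Int.cast_natCast, ← h1,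
          mdeg_apply, Prod.snd_sum, Finset.sum_apply, Int.cast_sum, Finset.sum_mul,
          Finset.mul_sum, ← hsum]
        refine Finset.sum_congr rfl fun χ _ => ?_
        rw [hβ]
        split_ifs with h
        · have h3 : ((n χ.1 : ℚ) : ℝ) = ((k * w χ.1 : ℚ) : ℝ) := by rw [hnk _ h]
          push_cast at h3
          simp [latticePt]
          rw [h3]
          ring
        · simp
      exact_mod_cast h2

/-! ### Convex upward maps and supporting linear maps -/

theorem toLex_smul_lt {N : ℕ} {c : ℝ} (hc : 0 < c) {a b : Fin N → ℝ} (h : toLex a < toLex b) :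
    toLex (c • a) < toLex (c • b) := by
  obtain ⟨i, hi, hlt⟩ := h
  exact ⟨i, fun j hj => congrArg (c * ·) (hi j hj), mul_lt_mul_of_pos_left hlt hc⟩

section
variable {d N : ℕ} {A : Finset (Fin d → ℤ)} {Q : PolytopalSubdivision A}
  {Ψ : Matrix (Fin N) A ℝ} {g : ℝ × (Fin d → ℝ) → Fin N → ℝ}

theorem mem_coneOver {D : Set (Fin d → ℝ)} {u : Fin d → ℝ} (hu : u ∈ D) :
    ((1 : ℝ), u) ∈ coneOver D := ⟨1, zero_le_one, u, hu, (one_smul ℝ _).symm⟩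

theorem polytope_subset {s : Finset (Fin d → ℤ)} (hs : s ∈ Q.cells) : polytope s ⊆ polytope A :=
  convexHull_mono (Set.image_mono (Q.marks_subset s hs))

/-- On the whole cone, `g` lies below the linear map with which it agrees on a cell. -/
theorem IsGKZMap.le_linear (hg : IsGKZMap Q Ψ g) {s : Finset (Fin d → ℤ)} (hs : s ∈ Q.cells)
    {ψ : (ℝ × (Fin d → ℝ)) →ₗ[ℝ] (Fin N → ℝ)} (hψ : ∀ x ∈ coneOver (polytope s), g x = ψ x)
    {w : Fin d → ℝ} (hw : w ∈ polytope A) : toLex (g (1, w)) ≤ toLex (ψ (1, w)) := by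
  obtain ⟨v, hv⟩ : (interior (polytope s)).Nonempty :=
    (convex_convexHull ℝ _).interior_nonempty_iff_affineSpan_eq_top.2 (Q.full_dim s hs)
  have hvs := interior_subset hv
  -- a point of the segment from `v` to `w` in the cell, different from `v`
  obtain ⟨ε, hε0, hε1, hε⟩ : ∃ ε : ℝ, 0 < ε ∧ ε ≤ 1 ∧ ε • w + (1 - ε) • v ∈ polytope s := by
    have hc : Continuous fun ε : ℝ => ε • w + (1 - ε) • v := by fun_prop
    have h0 : (fun ε : ℝ => ε • w + (1 - ε) • v) ⁻¹' interior (polytope s) ∈ nhds (0 : ℝ) :=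
      (isOpen_interior.preimage hc).mem_nhds (by simpa using hv)
    obtain ⟨δ, hδ, hball⟩ := Metric.mem_nhds_iff.1 h0
    refine ⟨min (δ / 2) 1, by positivity, min_le_right _ _, interior_subset (hball ?_)⟩
    rw [Metric.mem_ball, Real.dist_eq, sub_zero, abs_of_pos (by positivity)]
    exact (min_le_left _ _).trans_lt (half_lt_self hδ)
  have h := hg.convex_upward.2 _ (mem_coneOver hw) _ (mem_coneOver (polytope_subset hs hvs)) ε
    hε0.le hε1
  have hz : ε • ((1 : ℝ), w) + (1 - ε) • ((1 : ℝ), v) = (1, ε • w + (1 - ε) • v) := by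
    ext <;> simp
  rw [hz, hψ _ (mem_coneOver hε), ← hz, ψ.map_add, ψ.map_smul, ψ.map_smul,
    hψ _ (mem_coneOver hvs)] at h
  by_contra! hlt
  exact h.not_gt (add_lt_add_left (toLex_smul_lt hε0 hlt) _)

/-- `g` agrees with the linear map of a cell only on the cone over that cell: the points of
agreement form a convex domain of linearity. -/
theorem IsGKZMap.mem_polytope_of_eq (hg : IsGKZMap Q Ψ g) {s : Finset (Fin d → ℤ)}
    (hs : s ∈ Q.cells) (hmax : IsDomainOfLinearity (polytope A) g (polytope s))
    {ψ : (ℝ × (Fin d → ℝ)) →ₗ[ℝ] (Fin N → ℝ)} (hψ : ∀ x ∈ coneOver (polytope s), g x = ψ x)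
    {w : Fin d → ℝ} (hw : w ∈ polytope A) (h : g (1, w) = ψ (1, w)) : w ∈ polytope s := by
  -- the set where `g` agrees with `ψ`
  let E : Set (Fin d → ℝ) := {z | z ∈ polytope A ∧ g (1, z) = ψ (1, z)}
  have hsE : polytope s ⊆ E := fun z hz => ⟨polytope_subset hs hz, hψ _ (mem_coneOver hz)⟩
  have hconv : Convex ℝ E := by
    intro x hx y hy a b ha hb hab
    have hz := convex_convexHull ℝ _ hx.1 hy.1 ha hb hab
    refine ⟨hz, ?_⟩
    obtain rfl : b = 1 - a := by linarith
    have h1 := hg.convex_upward.2 _ (mem_coneOver hx.1) _ (mem_coneOver hy.1) a ha (by linarith)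
    have h2 : a • ((1 : ℝ), x) + (1 - a) • ((1 : ℝ), y) = (1, a • x + (1 - a) • y) := by
      ext <;> simp
    rw [hx.2, hy.2, ← map_smul, ← map_smul, ← map_add, h2] at h1
    exact toLex.injective ((hg.le_linear hs hψ hz).antisymm h1)
  have hclosed : IsClosed E := by
    have hP : IsClosed (polytope A) :=
      ((A.finite_toSet.image latticePt).isCompact_convexHull (𝕜 := ℝ)).isClosed
    have hcont : ContinuousOn (fun z => g (1, z) - ψ (1, z)) (polytope A) := by
      refine ContinuousOn.sub (hg.convex_upward.1.comp (by fun_prop) fun z hz => mem_coneOver hz) ?_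
      have := ψ.continuous_of_finiteDimensional
      exact (this.comp (by fun_prop : Continuous fun z : Fin d → ℝ => ((1 : ℝ), z))).continuousOn
    have h1 := hcont.preimage_isClosed_of_isClosed hP isClosed_singleton (t := {0})
    convert h1 using 1
    ext z
    exact and_congr_right fun _ => sub_eq_zero.symm
  have hint : (interior E).Nonempty :=
    ((convex_convexHull ℝ _).interior_nonempty_iff_affineSpan_eq_top.2
      (Q.full_dim s hs)).mono (interior_mono hsE)
  have hdom : IsDomainIn (polytope A) E := by
    refine ⟨fun z hz => hz.1, interior E, isOpen_interior,
      ⟨hint, hconv.interior.isPreconnected⟩, fun z hz => (interior_subset hz).1, ?_⟩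
    rw [hconv.closure_interior_eq_closure_of_nonempty_interior hint, hclosed.closure_eq]
  have hlin : LinearOnCone g E := by
    refine ⟨ψ, ?_⟩
    rintro _ ⟨c, hc, u, hu, rfl⟩
    obtain ⟨t, ht, hut⟩ := Set.mem_iUnion₂.1 (Q.cover.symm.subset hu.1)
    obtain ⟨φ, hφ⟩ := hg.piecewise_linear t ht
    rw [hφ _ ⟨c, hc, u, hut, rfl⟩, map_smul, ← hφ _ (mem_coneOver hut), hu.2, map_smul]
  exact hmax.2 ⟨hdom, hlin⟩ hsE ⟨hw, h⟩

/-- The polytope of a cell is a domain of linearity, and the cell is its marking. -/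
theorem isDomainOfLinearity_of_mem_cells
    (h : linearityPolytopes Ψ g = Q.markedPolytopes) {s : Finset (Fin d → ℤ)} (hs : s ∈ Q.cells) :
    IsDomainOfLinearity (polytope A) g (polytope s) ∧ ∀ m, m ∈ s ↔
      ∃ h : m ∈ A, latticePt m ∈ polytope s ∧ g (1, latticePt m) = fun k => Ψ k ⟨m, h⟩ := by
  obtain ⟨h1, h2⟩ := h.symm.subset ⟨s, hs, rfl⟩
  exact ⟨h1, fun m => Set.ext_iff.1 h2 m⟩

/-- Different cells are not contained in each other. -/
theorem eq_of_subset_of_mem_openGKZCone (hΨ : Ψ ∈ openGKZCone Q N) {s t : Finset (Fin d → ℤ)}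
    (hs : s ∈ Q.cells) (ht : t ∈ Q.cells) (hst : s ⊆ t) : s = t := by
  obtain ⟨g, -, h⟩ := hΨ
  obtain ⟨hs1, hs2⟩ := isDomainOfLinearity_of_mem_cells h hs
  obtain ⟨ht1, ht2⟩ := isDomainOfLinearity_of_mem_cells h ht
  have hP : polytope s = polytope t :=
    hs1.eq_of_le ht1.prop (convexHull_mono (Set.image_mono hst))
  ext m
  rw [hs2, ht2, hP]

/-- The linear map which agrees with the convex upward map on a cell is supporting. -/
theorem exists_isSupporting {Ψ : Matrix (Fin N) A ℚ}
    (hΨ : Ψ.map (fun q => (q : ℝ)) ∈ openGKZCone Q N) {s : Finset (Fin d → ℤ)}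
    (hs : s ∈ Q.cells) : ∃ u, IsSupporting Ψ s u := by
  obtain ⟨g, hg, h⟩ := hΨ
  obtain ⟨hs1, hs2⟩ := isDomainOfLinearity_of_mem_cells h hs
  obtain ⟨ψ, hψ⟩ := hg.piecewise_linear s hs
  let u : ℕ × (Fin d → ℤ) →+ Lex (Fin N → ℝ) :=
    { toFun := fun m => toLex (ψ ((m.1 : ℝ), latticePt m.2))
      map_zero' := by
        have : (((0 : ℕ) : ℝ), latticePt (0 : Fin d → ℤ)) = 0 := by
          ext <;> simp [latticePt]
        exact (congrArg ψ this).trans (map_zero ψ)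
      map_add' := fun m n => by
        have : (((m.1 + n.1 : ℕ) : ℝ), latticePt (m.2 + n.2)) =
            ((m.1 : ℝ), latticePt m.2) + ((n.1 : ℝ), latticePt n.2) := by
          ext <;> simp [latticePt]
        exact (congrArg ψ this).trans (map_add ψ _ _) }
  have hu : ∀ χ : Fin d → ℤ, u (1, χ) = toLex (ψ (1, latticePt χ)) := by
    intro χ
    show toLex (ψ (((1 : ℕ) : ℝ), latticePt χ)) = _
    rw [Nat.cast_one]
  refine ⟨u, fun χ => ?_⟩
  have hχA : latticePt χ.1 ∈ polytope A := subset_convexHull ℝ _ ⟨χ.1, χ.2, rfl⟩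
  have h1 : (toLex fun k => (Ψ k χ : ℝ)) ≤ toLex (g (1, latticePt χ.1)) := by
    by_cases hm : ∃ s ∈ Q.cells, (χ : Fin d → ℤ) ∈ s
    · exact (congrArg toLex (hg.eq_on_marks χ hm)).ge
    · exact hg.ge_off_marks χ hm
  have h2 := hg.le_linear hs hψ hχA
  rw [hu]
  refine ⟨h1.trans h2, fun heq => ?_, fun hχs => ?_⟩
  · have h3 : g (1, latticePt χ.1) = ψ (1, latticePt χ.1) :=
      toLex.injective (h2.antisymm (heq ▸ h1))
    exact (hs2 χ.1).2 ⟨χ.2, hg.mem_polytope_of_eq hs hs1 hψ hχA h3,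
      h3.trans (toLex.injective heq).symm⟩
  · obtain ⟨_, h3, h4⟩ := (hs2 χ.1).1 hχs
    rw [← hψ _ (mem_coneOver h3), h4]
    rfl

end

/-! ### The components of the semi-toric variety -/

section

open CategoryTheory AlgebraicGeometry

theorem affineSpan_eq_top_of_mem_cells {d : ℕ} {A : Finset (Fin d → ℤ)}
    {Q : PolytopalSubdivision A} {s : Finset (Fin d → ℤ)} (hs : s ∈ Q.cells) :
    affineSpan ℝ (latticePt '' (s : Set (Fin d → ℤ))) = ⊤ :=
  (affineSpan_convexHull _).symm.trans (Q.full_dim s hs)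

theorem nonempty_of_affineSpan_eq_top {d : ℕ} {s : Finset (Fin d → ℤ)}
    (hs : affineSpan ℝ (latticePt '' (s : Set (Fin d → ℤ))) = ⊤) : s.Nonempty := by
  rw [Finset.nonempty_iff_ne_empty]
  rintro rfl
  rw [Finset.coe_empty, Set.image_empty, AffineSubspace.span_empty] at hs
  exact bot_ne_top hs

theorem cells_nonempty {d : ℕ} {A : Finset (Fin d → ℤ)}
    (hA : affineSpan ℝ (latticePt '' (A : Set (Fin d → ℤ))) = ⊤) (Q : PolytopalSubdivision A) :
    Q.cells.Nonempty := by
  obtain ⟨χ, hχ⟩ := nonempty_of_affineSpan_eq_top hA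
  have h : latticePt χ ∈ polytope A := subset_convexHull ℝ _ ⟨χ, hχ, rfl⟩
  obtain ⟨s, hs, -⟩ := Set.mem_iUnion₂.1 (Q.cover.symm.subset h)
  exact ⟨s, hs⟩

section
attribute [local instance] MvPolynomial.gradedAlgebra

variable (K : Type u) [Field K] {d : ℕ}

theorem isIntegral_cellVariety {s : Finset (Fin d → ℤ)} (hs : s.Nonempty) :
    AlgebraicGeometry.IsIntegral (cellVariety K s).left := by
  obtain ⟨χ, hχ⟩ := hs
  refine isIntegral_projOver one_pos (single_cellGen_mem K ⟨χ, hχ⟩) ?_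
  rw [Ne, AddMonoidAlgebra.single_eq_zero]
  exact one_ne_zero

/-- The embedded toric variety is `Proj` of the monoid algebra. -/
def cellVarietyIso [CharZero K] (s : Finset (Fin d → ℤ)) : cellVariety K s ≅ toricVariety K s :=
  projIso (cellHom K s s) (cellHom_mem K s s) (cellHom_surjective K s s subset_rfl)
    (Ideal.Quotient.mkₐ K (toricIdeal K s)) (fun _ x hx => ⟨x, hx, rfl⟩)
    (Ideal.Quotient.mkₐ_surjective K _)
    ((toricIdeal_eq_ker K s).symm.trans (Ideal.Quotient.mkₐ_ker K _).symm)

/-- The variable of `χ` vanishes on the cell `t` exactly if `χ ∉ t`. -/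
theorem subset_of_ker_cellHom_le {A s t : Finset (Fin d → ℤ)} (hs : s ⊆ A)
    (h : RingHom.ker (cellHom K A t) ≤ RingHom.ker (cellHom K A s)) : s ⊆ t := by
  classical
  intro χ hχ
  by_contra hχt
  have h1 : cellHom K A t (MvPolynomial.X ⟨χ, hs hχ⟩) = 0 := by
    rw [← map_eq_zero_iff _ (cellIncl_injective K t), cellIncl_cellHom_X, if_neg hχt]
  have h2 := (RingHom.mem_ker).1 (h ((RingHom.mem_ker).2 h1))
  rw [← map_eq_zero_iff _ (cellIncl_injective K s), cellIncl_cellHom_X, if_pos hχ,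
    AddMonoidAlgebra.single_eq_zero] at h2
  exact one_ne_zero h2

variable [CharZero K] {A : Finset (Fin d → ℤ)} {N : ℕ}

/-- The kernel of `K[x_χ ∣ χ ∈ A] → Red(gr_{ν_Ψ} K[X̂_A])` depends only on the subdivision. -/
theorem ker_redHom_of_mem_openGKZCone
    (hA : affineSpan ℝ (latticePt '' (A : Set (Fin d → ℤ))) = ⊤) (Q : PolytopalSubdivision A)
    {Ψ : Matrix (Fin N) A ℚ} (hΨ : Ψ.map (fun q => (q : ℝ)) ∈ openGKZCone Q N) :
    RingHom.ker (redHom K Ψ) = ⨅ s ∈ Q.cells, RingHom.ker (cellHom K A s) :=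
  ker_redHom_eq (fun _ hs => exists_isSupporting hΨ hs)
    (exists_suppIn_mdeg_eq_nsmul Q.marks_subset Q.cover.symm.subset (cells_nonempty hA Q))

/-- The closed immersion of the toric variety of a cell into `Z_0`. -/
def cellImmersion {Q : PolytopalSubdivision A} {Ψ : Matrix (Fin N) A ℚ}
    (h : RingHom.ker (redHom K Ψ) = ⨅ s ∈ Q.cells, RingHom.ker (cellHom K A s)) (s : Q.cells) :
    cellVariety K s.1 ⟶ semiToric K Ψ :=
  projLift (redHom K Ψ) (redHom_mem K Ψ) (redHom_surjective K Ψ) (cellHom K A s.1)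
    (cellHom_mem K A s.1) (cellHom_surjective K A s.1 (Q.marks_subset s.1 s.2))
    (h.le.trans (iInf₂_le s.1 s.2))

variable {Q : PolytopalSubdivision A} {Ψ : Matrix (Fin N) A ℚ}
  (h : RingHom.ker (redHom K Ψ) = ⨅ s ∈ Q.cells, RingHom.ker (cellHom K A s))

theorem isClosedImmersion_cellImmersion (s : Q.cells) :
    IsClosedImmersion (cellImmersion K h s).left :=
  isClosedImmersion_projLift _ _ _ _ _ _ _

/-- The image of `Z_Q` consists of the homogeneous primes which contain the kernel of
`K[x_χ ∣ χ ∈ A] → K[S]`. -/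
theorem range_cellImmersion (s : Q.cells) : Set.range (cellImmersion K h s).left =
    {p : ProjectiveSpectrum (nuGrading (K := K) Ψ) |
      RingHom.ker (cellHom K A s.1) ≤ p.asHomogeneousIdeal.toIdeal.comap
        (redHom K Ψ : MvPolynomial A K →+* (nu (K := K) Ψ).RedGr)} :=
  range_projLift (redHom K Ψ) (redHom_mem K Ψ) (redHom_surjective K Ψ) (cellHom K A s.1)
    (cellHom_mem K A s.1) (cellHom_surjective K A s.1 (Q.marks_subset s.1 s.2))
    (h.le.trans (iInf₂_le s.1 s.2))

/-- The components cover, as a prime containing a finite intersection of ideals contains one of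
them. -/
theorem iUnion_range_cellImmersion :
    ⋃ s, Set.range (cellImmersion K h s).left = Set.univ := by
  refine Set.eq_univ_of_forall fun p => ?_
  let p' : ProjectiveSpectrum (nuGrading (K := K) Ψ) := p
  have hp : (p'.asHomogeneousIdeal.toIdeal.comap
      (redHom K Ψ : MvPolynomial A K →+* (nu (K := K) Ψ).RedGr)).IsPrime :=
    haveI := p'.isPrime
    Ideal.comap_isPrime _ _
  have hle : Q.cells.inf (fun s => (RingHom.ker (cellHom K A s) : Ideal (MvPolynomial A K))) ≤
      p'.asHomogeneousIdeal.toIdeal.comap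
        (redHom K Ψ : MvPolynomial A K →+* (nu (K := K) Ψ).RedGr) := by
    rw [Finset.inf_eq_iInf, ← h]
    intro x hx
    rw [Ideal.mem_comap]
    have hx0 : (redHom K Ψ : MvPolynomial A K →+* (nu (K := K) Ψ).RedGr) x = 0 := hx
    rw [hx0]
    exact Ideal.zero_mem _
  obtain ⟨s, hs, hsp⟩ := (Ideal.IsPrime.inf_le' hp).1 hle
  refine Set.mem_iUnion.2 ⟨⟨s, hs⟩, ?_⟩
  rw [range_cellImmersion]
  exact hsp

/-- The generic point of a component does not lie on another one. -/
theorem not_range_cellImmersion_subset (hΨ : Ψ.map (fun q => (q : ℝ)) ∈ openGKZCone Q N)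
    (s : Q.cells) : ¬ Set.range (cellImmersion K h s).left ⊆
      ⋃ (t) (_ : t ≠ s), Set.range (cellImmersion K h t).left := by
  intro hsub
  obtain ⟨χ, hχ⟩ := nonempty_of_affineSpan_eq_top (affineSpan_eq_top_of_mem_cells s.2)
  -- the generic point of the component
  let η : ProjectiveSpectrum (AddMonoidAlgebra.gradeBy K (cellDeg s.1)) :=
    ⟨⊥, Ideal.isPrime_bot, fun h => by
      have h1 := h (HomogeneousIdeal.mem_irrelevant_of_mem _ one_pos
        (single_cellGen_mem K ⟨χ, hχ⟩))
      exact one_ne_zero (AddMonoidAlgebra.single_eq_zero.1 h1)⟩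
  obtain ⟨t, hts, ht⟩ := Set.mem_iUnion₂.1 (hsub ⟨η, rfl⟩)
  rw [range_cellImmersion] at ht
  refine hts (Subtype.ext (eq_of_subset_of_mem_openGKZCone hΨ s.2 t.2
    (subset_of_ker_cellHom_le K (Q.marks_subset s.1 s.2) fun x hx => ?_)).symm)
  exact (mem_projLift (redHom K Ψ) (redHom_mem K Ψ) (redHom_surjective K Ψ) (cellHom K A s.1)
    (cellHom_mem K A s.1) (cellHom_surjective K A s.1 (Q.marks_subset s.1 s.2))
    (h.le.trans (iInf₂_le s.1 s.2)) η x).1 (ht hx)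

theorem topologicalKrullDim_toricVariety
    (hA : affineSpan ℝ (latticePt '' (A : Set (Fin d → ℤ))) = ⊤) :
    topologicalKrullDim (toricVariety K A).left = d := by
  rw [← topologicalKrullDim_cellVariety K hA (nonempty_of_affineSpan_eq_top hA)]
  have e := Scheme.homeoOfIso ((Over.forget _).mapIso (cellVarietyIso K A))
  exact (e.isHomeomorph.topologicalKrullDim_eq _).symm

theorem topologicalKrullDim_of_mem_irreducibleComponents
    (h : RingHom.ker (redHom K Ψ) = ⨅ s ∈ Q.cells, RingHom.ker (cellHom K A s))
    {T : Set (semiToric K Ψ).left}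
    (hT : T ∈ irreducibleComponents (semiToric K Ψ).left) : topologicalKrullDim T = d := by
  have hemb : ∀ s, Topology.IsClosedEmbedding (cellImmersion K h s).left :=
    fun s => (isClosedImmersion_cellImmersion K h s).isClosedEmbedding
  have hne : ∀ s : Q.cells, s.1.Nonempty := fun s =>
    nonempty_of_affineSpan_eq_top (affineSpan_eq_top_of_mem_cells s.2)
  have hirr : ∀ s, IsIrreducible (Set.range (cellImmersion K h s).left) := by
    intro s
    have := isIntegral_cellVariety K (hne s)
    rw [← Set.image_univ]
    exact (IrreducibleSpace.isIrreducible_univ _).image _ (hemb s).continuous.continuousOn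
  obtain ⟨s, rfl⟩ := exists_eq_of_mem_irreducibleComponents (fun s => (hemb s).isClosed_range)
    hirr (iUnion_range_cellImmersion K h) hT
  rw [← topologicalKrullDim_cellVariety K (affineSpan_eq_top_of_mem_cells s.2) (hne s)]
  exact ((hemb s).isEmbedding.toHomeomorph.isHomeomorph.topologicalKrullDim_eq _).symm

end

end

end HigherGKZ

end
theorem mainTheorem11 (K : Type*) [Field K] [IsAlgClosed K] [CharZero K] {d : ℕ}
    (A : Finset (Fin d → ℤ))
    (hA : affineSpan ℝ (HigherGKZ.latticePt '' (A : Set (Fin d → ℤ))) = ⊤)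
    (Q : HigherGKZ.PolytopalSubdivision A) :
    -- `Red(gr_{ν_Ψ} K[X̂_A])` is finitely generated
    (∀ (N : ℕ) (Ψ : Matrix (Fin N) A ℚ), Ψ.map (fun q => (q : ℝ)) ∈ HigherGKZ.openGKZCone Q N →
      Algebra.FiniteType K (HigherGKZ.nu (K := K) Ψ).RedGr) ∧
    -- each `Z_Q = Proj K[S^1_Q]` is a (projective) toric variety
    (∀ s ∈ Q.cells, AlgebraicGeometry.IsIntegral (HigherGKZ.cellVariety K s).left ∧
      Nonempty (HigherGKZ.cellVariety K s ≅ HigherGKZ.toricVariety K s)) ∧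
    -- there are morphisms of `K`-schemes `ι : Z_Q ⟶ Z_0`
    ∃ ι : ∀ (N : ℕ) (Ψ : Matrix (Fin N) A ℚ),
        Ψ.map (fun q => (q : ℝ)) ∈ HigherGKZ.openGKZCone Q N →
        ∀ s : Q.cells, HigherGKZ.cellVariety K s.1 ⟶ HigherGKZ.semiToric K Ψ,
      (∀ (N : ℕ) (Ψ : Matrix (Fin N) A ℚ)
          (hΨ : Ψ.map (fun q => (q : ℝ)) ∈ HigherGKZ.openGKZCone Q N),
        -- `Z_0` is reduced
        AlgebraicGeometry.IsReduced (HigherGKZ.semiToric K Ψ).left ∧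
        -- `Z_0` is the irredundant union of the closed subschemes `Z_Q`
        (∀ s, AlgebraicGeometry.IsClosedImmersion (ι N Ψ hΨ s).left) ∧
        (⋃ s, Set.range (ι N Ψ hΨ s).left) = Set.univ ∧
        (∀ s, ¬ Set.range (ι N Ψ hΨ s).left ⊆
          ⋃ (t) (_ : t ≠ s), Set.range (ι N Ψ hΨ t).left) ∧
        -- `Z_0` is equidimensional of dimension `dim X_A`
        (∀ T ∈ irreducibleComponents (HigherGKZ.semiToric K Ψ).left,
          topologicalKrullDim T = topologicalKrullDim (HigherGKZ.toricVariety K A).left)) ∧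
      -- `Z_0`, with its subschemes `Z_Q`, depends only on the subdivision
      (∀ (N N' : ℕ) (Ψ : Matrix (Fin N) A ℚ) (Ψ' : Matrix (Fin N') A ℚ)
          (hΨ : Ψ.map (fun q => (q : ℝ)) ∈ HigherGKZ.openGKZCone Q N)
          (hΨ' : Ψ'.map (fun q => (q : ℝ)) ∈ HigherGKZ.openGKZCone Q N'),
        ∃ e : HigherGKZ.semiToric K Ψ ≅ HigherGKZ.semiToric K Ψ',
          ∀ s, CategoryTheory.CategoryStruct.comp (ι N Ψ hΨ s) e.hom = ι N' Ψ' hΨ' s) := by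

  have hker : ∀ {N : ℕ} {Ψ : Matrix (Fin N) A ℚ},
      Ψ.map (fun q => (q : ℝ)) ∈ HigherGKZ.openGKZCone Q N → _ :=
    fun hΨ => HigherGKZ.ker_redHom_of_mem_openGKZCone K hA Q hΨ
  refine ⟨fun N Ψ _ => ?_, fun s hs => ?_, fun N Ψ hΨ s => HigherGKZ.cellImmersion K (hker hΨ) s,
    fun N Ψ hΨ => ?_, fun N N' Ψ Ψ' hΨ hΨ' => ?_⟩
  · exact Algebra.FiniteType.of_surjective (HigherGKZ.redHom K Ψ)
      (HigherGKZ.redHom_surjective K Ψ)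
  · exact ⟨HigherGKZ.isIntegral_cellVariety K (HigherGKZ.nonempty_of_affineSpan_eq_top
      (HigherGKZ.affineSpan_eq_top_of_mem_cells hs)), ⟨HigherGKZ.cellVarietyIso K s⟩⟩
  · refine ⟨HigherGKZ.isReduced_projOver,
      HigherGKZ.isClosedImmersion_cellImmersion K (hker hΨ),
      HigherGKZ.iUnion_range_cellImmersion K (hker hΨ),
      HigherGKZ.not_range_cellImmersion_subset K (hker hΨ) hΨ, fun T hT => ?_⟩
    rw [HigherGKZ.topologicalKrullDim_toricVariety K hA]
    exact HigherGKZ.topologicalKrullDim_of_mem_irreducibleComponents K (hker hΨ) hT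
  · let := MvPolynomial.gradedAlgebra (σ := A) (R := K)
    exact ⟨HigherGKZ.projIso (HigherGKZ.redHom K Ψ) (HigherGKZ.redHom_mem K Ψ)
      (HigherGKZ.redHom_surjective K Ψ) (HigherGKZ.redHom K Ψ') (HigherGKZ.redHom_mem K Ψ')
      (HigherGKZ.redHom_surjective K Ψ') ((hker hΨ).trans (hker hΨ').symm),
      fun s => HigherGKZ.projLift_comp _ _ _ _ _ _ _ _ _ _ _⟩
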